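/- Lie groupoids $\Sigma\rightrightarrows M$ are smooth and finite-dimensional, with source $\alpha$ and target $\beta$ submersions and product $m(g,h)=gh$ defined when $\alpha(g)=\beta(h)$; the base $M$ and the $\alpha$-fibres are Hausdorff, while $\Sigma$ need not be. Let $\Sigma_2\subset\Sigma\times\Sigma$ be the manifold of composable pairs, with projections $pr_1,pr_2$. A \emph{contact groupoid structure on $\Sigma$ with Reeb function $r$} is a contact form $\theta$ on $\Sigma$ (a smooth $1$-form with $\theta\wedge(d\theta)^n$ nowhere zero, where $\dim\Sigma=2n+1$) such that $m^*\theta = pr_2^*(e^{-r})\cdot pr_1^*\theta + pr_2^*\theta$ on $\Sigma_2$. A \emph{homogeneous symplectic groupoid structure} on a Lie groupoid is a pair $(\omega,Z)$, where $\omega$ is a symplectic form on the manifold of arrows that is multiplicative ($m^*\omega=pr_1^*\omega+pr_2^*\omega$ on the composable pairs) and $Z$, called the homogeneous vector field, is a multiplicative vector field (a smooth vector field which, viewed as a map to the tangent groupoid, is a groupoid morphism over a smooth vector field of the base), with $\mathcal L_Z\omega=\omega$. Let $\Sigma$ be a Lie groupoid over $M$ and let $r:\Sigma\to\mathbb R$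 be a smooth function that is multiplicative, i.e. $r(gh)=r(g)+r(h)$ whenever $gh$ is defined. Let $\Sigma\times_r\mathbb R$ be the Lie groupoid over $M\times\mathbb R$ with arrows $\Sigma\times\mathbb R$ and $$\alpha(g,s)=(\alpha(g),s),\qquad \beta(g,s)=(\beta(g),s-r(g)),\qquad (g_1,s_1)(g_2,s_2)=(g_1g_2,s_2),$$ and let $s$ be the coordinate on $\mathbb R$ and $pr_\Sigma:\Sigma\times\mathbb R\to\Sigma$ the projection. Then $$\theta\longmapsto \omega=d\bigl(e^{s}\,pr_\Sigma^*\theta\bigr)$$ is a bijection from the set of contact groupoid structures $\theta$ on $\Sigma$ with Reeb function $r$ onto the set of $2$-forms $\omega$ for which $(\omega,\partial/\partial s)$ is a homogeneous symplectic groupoid structure on $\Sigma\times_r\mathbb R$. Its inverse sends $\omega$ to the restriction of $\iota_{\partial/\partial s}\,\omega$ to $\Sigma=\Sigma\times\{0\}$. -/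

import Mathlib

open Set Function
open scoped Manifold ContDiff Topology

noncomputable section

namespace ContactGroupoid

/-! ### Differential forms and vector fields on manifolds

All manifolds below are finite-dimensional, smooth and without boundary; they need not be Hausdorff
unless this is said. -/

section Forms

variable {E : Type*} [NormedAddCommGroup E] [NormedSpace ℝ E]
  {H : Type*} [TopologicalSpace H] (I : ModelWithCorners ℝ E H)
  (X : Type*) [TopologicalSpace X] [ChartedSpace H X]

/-- A (not necessarily smooth) differential `k`-form on `X`. -/
abbrev DForm (k : ℕ) : Type _ := ∀ p : X, TangentSpace I p [⋀^Fin k]→L[ℝ] ℝ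

/-- A (not necessarily smooth) vector field on `X`. -/
abbrev VField : Type _ := ∀ p : X, TangentSpace I p

variable {X} {k : ℕ}

/-- A vector field is smooth if it is smooth as a section of the tangent bundle. -/
def IsSmoothVField [IsManifold I ∞ X] (Z : VField I X) : Prop :=
  ContMDiff I I.tangent ∞ (fun p ↦ (⟨p, Z p⟩ : TangentBundle I X))

/-- The expression of the form `Ω` in the chart at `x`: the pullback of `Ω` along the inverse of
the chart, a form on the open set `(extChartAt I x).target` of `E`. -/
def DForm.inChart (Ω : DForm I X k) (x : X) (y : E) : E [⋀^Fin k]→L[ℝ] ℝ :=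
  ContinuousAlternatingMap.compContinuousLinearMap (Ω ((extChartAt I x).symm y))
    (mfderiv 𝓘(ℝ, E) I (extChartAt I x).symm y)

/-- The expression of the vector field `Z` in the chart at `x`. -/
def VField.inChart (Z : VField I X) (x : X) (y : E) : E :=
  mfderiv I 𝓘(ℝ, E) (extChartAt I x) ((extChartAt I x).symm y) (Z ((extChartAt I x).symm y))

/-- A form is smooth if its expression in each chart is smooth. -/
def DForm.IsSmooth (Ω : DForm I X k) : Prop :=
  ∀ x : X, ContDiffOn ℝ ∞ (DForm.inChart I Ω x) (extChartAt I x).target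

/-- The exterior derivative, computed at `p` in the chart at `p`. -/
def DForm.d (Ω : DForm I X k) : DForm I X (k + 1) := fun p ↦
  ContinuousAlternatingMap.compContinuousLinearMap
    (extDeriv (DForm.inChart I Ω p) (extChartAt I p p))
    (mfderiv I 𝓘(ℝ, E) (extChartAt I p) p)

/-- The contraction `ι_Z Ω`: the field `Z` is inserted in the first slot of `Ω`. -/
def DForm.contract (Z : VField I X) (Ω : DForm I X (k + 1)) : DForm I X k := fun p ↦
  ContinuousAlternatingMap.curryLeft (E := E) (Ω p) (Z p)

/-- The Lie derivative `(L_Z Ω)_p (v₁, …, v_k)`, computed at `p` in the chart at `p` by the formula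
`(L_Z Ω)_y (v₁, …, v_k) = (D_y Ω · Z(y)) (v₁, …, v_k) + ∑ᵢ Ω_y (v₁, …, D_y Z · vᵢ, …, v_k)`. -/
def DForm.lieDeriv (Z : VField I X) (Ω : DForm I X k) (p : X) (v : Fin k → TangentSpace I p) : ℝ :=
  let y : E := extChartAt I p p
  let w : Fin k → E := fun i ↦ mfderiv I 𝓘(ℝ, E) (extChartAt I p) p (v i)
  fderiv ℝ (DForm.inChart I Ω p) y (VField.inChart I Z p y) w
    + ∑ i, DForm.inChart I Ω p y (Function.update w i (fderiv ℝ (VField.inChart I Z p) y (w i)))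

/-- The value of `θ ∧ σⁿ` on `2 n + 1` vectors, for an alternating 1-form `θ` and an alternating
2-form `σ`; with the usual normalisation of the wedge product it is
`(θ ∧ σⁿ)(v₀, …, v₂ₙ) = 2⁻ⁿ ∑_π sgn(π) θ(v_{π 0}) σ(v_{π 1}, v_{π 2}) ⋯ σ(v_{π (2n-1)}, v_{π (2n)})`,
the sum running over all permutations of the indices. -/
def wedgePow (θ : E [⋀^Fin 1]→L[ℝ] ℝ) (σ : E [⋀^Fin 2]→L[ℝ] ℝ) (n : ℕ)
    (v : Fin (2 * n + 1) → E) : ℝ :=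
  ((2 : ℝ) ^ n)⁻¹ * ∑ π : Equiv.Perm (Fin (2 * n + 1)), ((Equiv.Perm.sign π : ℤ) : ℝ) *
    (θ ![v (π 0)] * ∏ i : Fin n, σ ![v (π ⟨2 * i.val + 1, by omega⟩),
      v (π ⟨2 * i.val + 2, by omega⟩)])

/-- A contact form on a manifold of dimension `2 n + 1`: a smooth 1-form `θ` such that
`θ ∧ (dθ)ⁿ` vanishes nowhere. -/
def IsContactForm (θ : DForm I X 1) : Prop :=
  DForm.IsSmooth I θ ∧ ∀ p : X, ∃ n : ℕ, Module.finrank ℝ E = 2 * n + 1 ∧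
    ∃ v : Fin (2 * n + 1) → E, wedgePow (E := E) (θ p) (DForm.d I θ p) n v ≠ 0

/-- A symplectic form: a smooth, closed and nondegenerate 2-form. -/
def IsSymplecticForm (Ω : DForm I X 2) : Prop :=
  DForm.IsSmooth I Ω ∧ (∀ p, DForm.d I Ω p = 0) ∧
    ∀ (p : X) (u : TangentSpace I p), (∀ v : TangentSpace I p, Ω p ![u, v] = 0) → u = 0

/-- The pullback of a form along a map `f`. -/
def DForm.pullback {E' : Type*} [NormedAddCommGroup E'] [NormedSpace ℝ E']
    {H' : Type*} [TopologicalSpace H'] (I' : ModelWithCorners ℝ E' H')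
    {Y : Type*} [TopologicalSpace Y] [ChartedSpace H' Y]
    (f : X → Y) (Ω : DForm I' Y k) : DForm I X k := fun p ↦
  ContinuousAlternatingMap.compContinuousLinearMap (Ω (f p)) (mfderiv I I' f p)

end Forms

/-! ### Lie groupoids -/

section Groupoids

variable {E : Type*} [NormedAddCommGroup E] [NormedSpace ℝ E]
  {H : Type*} [TopologicalSpace H] (I : ModelWithCorners ℝ E H)
  {F : Type*} [NormedAddCommGroup F] [NormedSpace ℝ F]
  {K : Type*} [TopologicalSpace K] (J : ModelWithCorners ℝ F K)
  (G : Type*) [TopologicalSpace G] [ChartedSpace H G]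
  (M : Type*) [TopologicalSpace M] [ChartedSpace K M]

/-- A Lie groupoid with manifold of arrows `G` and manifold of objects `M`. The product
`mul g h` (`= g h`) is meaningful only for composable arrows, i.e. `src g = tgt h`; the values of
the function `mul` on other pairs play no role. The base and the source fibres are Hausdorff, `G`
need not be.

As the source and the target are submersions, the set of composable pairs is an embedded submanifold
of `G × G`; a map on it is smooth iff it is `ContMDiffOn` on this subset of `G × G`. -/
structure LieGroupoid where
  src : G → M
  tgt : G → M
  one : M → G
  inv : G → G
  mul : G → G → G
  src_one : ∀ x, src (one x) = x
  tgt_one : ∀ x, tgt (one x) = x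
  src_mul : ∀ g h, src g = tgt h → src (mul g h) = src h
  tgt_mul : ∀ g h, src g = tgt h → tgt (mul g h) = tgt g
  mul_assoc : ∀ g h k, src g = tgt h → src h = tgt k → mul (mul g h) k = mul g (mul h k)
  one_mul : ∀ g, mul (one (tgt g)) g = g
  mul_one : ∀ g, mul g (one (src g)) = g
  src_inv : ∀ g, src (inv g) = tgt g
  tgt_inv : ∀ g, tgt (inv g) = src g
  inv_mul : ∀ g, mul (inv g) g = one (src g)
  mul_inv : ∀ g, mul g (inv g) = one (tgt g)
  t2_base : T2Space M
  t2_fiber : ∀ x : M, T2Space {g : G // src g = x}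
  submersion_src : Manifold.IsSubmersion I J ∞ src
  submersion_tgt : Manifold.IsSubmersion I J ∞ tgt
  smooth_one : ContMDiff J I ∞ one
  smooth_inv : ContMDiff I I ∞ inv
  smooth_mul : ContMDiffOn (I.prod I) I ∞ (fun q : G × G ↦ mul q.1 q.2)
    {q : G × G | src q.1 = tgt q.2}

end Groupoids

namespace LieGroupoid

variable {E : Type*} [NormedAddCommGroup E] [NormedSpace ℝ E]
  {H : Type*} [TopologicalSpace H] {I : ModelWithCorners ℝ E H}
  {F : Type*} [NormedAddCommGroup F] [NormedSpace ℝ F]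
  {K : Type*} [TopologicalSpace K] {J : ModelWithCorners ℝ F K}
  {G : Type*} [TopologicalSpace G] [ChartedSpace H G]
  {M : Type*} [TopologicalSpace M] [ChartedSpace K M]
  (𝒢 : LieGroupoid I J G M)

/-- The set `Σ₂` of composable pairs. -/
def composable : Set (G × G) := {q | 𝒢.src q.1 = 𝒢.tgt q.2}

/-- `(u, v)`, with `u` tangent at `g` and `v` tangent at `h`, is tangent to the manifold of
composable pairs at `(g, h)`; that is, `u` and `v` are composable arrows of the tangent groupoid:
`dα(u) = dβ(v)` in the tangent bundle of the base. -/
def TangentComposable {g h : G} (u : TangentSpace I g) (v : TangentSpace I h) : Prop :=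
  tangentMap I J 𝒢.src ⟨g, u⟩ = tangentMap I J 𝒢.tgt ⟨h, v⟩

/-- The derivative `dm(u, v)` of the multiplication `m : Σ₂ → Σ` at the composable pair `(g, h)`,
i.e. the product in the tangent groupoid. It is meaningful only for pairs `(u, v)` that are tangent
to `Σ₂`; on those all derivatives of `m` within `Σ₂` have the same value. -/
def tangentMul {g h : G} (u : TangentSpace I g) (v : TangentSpace I h) :
    TangentSpace I (𝒢.mul g h) :=
  mfderivWithin (I.prod I) I (fun q : G × G ↦ 𝒢.mul q.1 q.2) 𝒢.composable (g, h) (u, v)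

/-- A real function `r` on the arrows is multiplicative if `r (g h) = r g + r h`. -/
def IsMultiplicativeFun (r : G → ℝ) : Prop :=
  ∀ g h, 𝒢.src g = 𝒢.tgt h → r (𝒢.mul g h) = r g + r h

/-- `θ` is a contact groupoid structure with Reeb function `r`: a contact form with
`m^* θ = pr₂^*(e^{-r}) · pr₁^* θ + pr₂^* θ` on the manifold of composable pairs. -/
def IsContactStructure (θ : DForm I G 1) (r : G → ℝ) : Prop :=
  IsContactForm I θ ∧
    ∀ g h, 𝒢.src g = 𝒢.tgt h → ∀ (u : TangentSpace I g) (v : TangentSpace I h),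
      𝒢.TangentComposable u v →
        θ (𝒢.mul g h) ![𝒢.tangentMul u v] = Real.exp (-r h) * θ g ![u] + θ h ![v]

/-- A 2-form `Ω` on the arrows is multiplicative: `m^* Ω = pr₁^* Ω + pr₂^* Ω` on the manifold
of composable pairs. -/
def IsMultiplicativeForm (Ω : DForm I G 2) : Prop :=
  ∀ g h, 𝒢.src g = 𝒢.tgt h →
    ∀ (u u' : TangentSpace I g) (v v' : TangentSpace I h),
      𝒢.TangentComposable u v → 𝒢.TangentComposable u' v' →
        Ω (𝒢.mul g h) ![𝒢.tangentMul u v, 𝒢.tangentMul u' v'] = Ω g ![u, u'] + Ω h ![v, v']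

/-- A vector field `Z` on the arrows is multiplicative: it is smooth and, for some smooth vector
field `Z₀` on the base, `Z : G → TG` is a groupoid morphism over `Z₀ : M → TM`. -/
def IsMultiplicativeVField [IsManifold I ∞ G] [IsManifold J ∞ M] (Z : VField I G) : Prop :=
  IsSmoothVField I Z ∧ ∃ Z₀ : VField J M, IsSmoothVField J Z₀ ∧
    (∀ g, tangentMap I J 𝒢.src ⟨g, Z g⟩ = ⟨𝒢.src g, Z₀ (𝒢.src g)⟩) ∧
    (∀ g, tangentMap I J 𝒢.tgt ⟨g, Z g⟩ = ⟨𝒢.tgt g, Z₀ (𝒢.tgt g)⟩) ∧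
    (∀ x, tangentMap J I 𝒢.one ⟨x, Z₀ x⟩ = ⟨𝒢.one x, Z (𝒢.one x)⟩) ∧
    ∀ g h, 𝒢.src g = 𝒢.tgt h → 𝒢.tangentMul (Z g) (Z h) = Z (𝒢.mul g h)

/-- `(Ω, Z)` makes the Lie groupoid a homogeneous symplectic groupoid: `Ω` is a multiplicative
symplectic form, `Z` is a multiplicative vector field, and `L_Z Ω = Ω`. -/
def IsHomogeneousSymplectic [IsManifold I ∞ G] [IsManifold J ∞ M] (Ω : DForm I G 2) (Z : VField I G) : Prop :=
  IsSymplecticForm I Ω ∧ 𝒢.IsMultiplicativeForm Ω ∧ 𝒢.IsMultiplicativeVField Z ∧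
    ∀ (p : G) (v : Fin 2 → TangentSpace I p), DForm.lieDeriv I Z Ω p v = Ω p v

/-! ### The groupoid `Σ ×_r ℝ` -/

/-- Precomposing a submersion with a diffeomorphism gives a submersion. -/
theorem isSubmersion_comp_diffeomorph [IsManifold I ∞ G] {f : G → M}
    (hf : Manifold.IsSubmersion I J ∞ f) (Φ : G ≃ₘ^∞⟮I, I⟯ G) :
    Manifold.IsSubmersion I J ∞ (f ∘ Φ) := by
  obtain ⟨C, i1, i2, hC⟩ := hf
  refine ⟨C, i1, i2, fun x ↦ ?_⟩
  have h := hC (Φ x)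
  let φ : OpenPartialHomeomorph G H := Φ.toHomeomorph.toOpenPartialHomeomorph ≫ₕ h.domChart
  have hsrc : φ.source = Φ ⁻¹' h.domChart.source := by
    ext y
    simp [φ]
  have htgt : φ.target = h.domChart.target := by
    ext y
    simp [φ]
  refine Manifold.IsSubmersionAtOfComplement.mk_of_charts h.equiv φ h.codChart ?_
    h.mem_codChart_source ?_ h.codChart_mem_maximalAtlas ?_ ?_
  · rw [hsrc]
    exact h.mem_domChart_source
  · rw [IsManifold.mem_maximalAtlas_iff_contMDiffOn]
    constructor
    · have h1 := contMDiffOn_of_mem_maximalAtlas h.domChart_mem_maximalAtlas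
      have h2 := h1.comp (Φ.contMDiff.contMDiffOn (s := φ.source)) (by rw [hsrc])
      exact h2
    · have h1 := contMDiffOn_symm_of_mem_maximalAtlas h.domChart_mem_maximalAtlas
      have h2 := Φ.symm.contMDiff.comp_contMDiffOn h1
      rw [htgt]
      exact h2
  · rw [hsrc]
    exact fun y hy ↦ h.source_subset_preimage_source hy
  · intro y hy
    have hy' : y ∈ (h.domChart.extend I).target := by
      simp only [OpenPartialHomeomorph.extend_target, htgt] at hy ⊢
      exact hy
    have := h.writtenInCharts hy'
    rw [← this]
    simp [φ]

/-- The diffeomorphism `(g, s) ↦ (g, s - r g)` of `Σ × ℝ`. -/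
def shear {r : G → ℝ} (hr : ContMDiff I 𝓘(ℝ, ℝ) ∞ r) :
    (G × ℝ) ≃ₘ^∞⟮I.prod 𝓘(ℝ, ℝ), I.prod 𝓘(ℝ, ℝ)⟯ (G × ℝ) where
  toFun p := (p.1, p.2 - r p.1)
  invFun p := (p.1, p.2 + r p.1)
  left_inv p := by simp
  right_inv p := by simp
  contMDiff_toFun := contMDiff_fst.prodMk (contMDiff_snd.sub (hr.comp contMDiff_fst))
  contMDiff_invFun := contMDiff_fst.prodMk (contMDiff_snd.add (hr.comp contMDiff_fst))

variable {𝒢} in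
theorem IsMultiplicativeFun.map_one {r : G → ℝ} (h : 𝒢.IsMultiplicativeFun r) (x : M) :
    r (𝒢.one x) = 0 := by
  have h1 := h (𝒢.one x) (𝒢.one x) (by rw [𝒢.src_one, 𝒢.tgt_one])
  have h2 := 𝒢.mul_one (𝒢.one x)
  rw [𝒢.src_one] at h2
  rw [h2] at h1
  linarith

variable {𝒢} in
theorem IsMultiplicativeFun.map_inv {r : G → ℝ} (h : 𝒢.IsMultiplicativeFun r) (g : G) :
    r (𝒢.inv g) = - r g := by
  have h1 := h (𝒢.inv g) g (𝒢.src_inv g)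
  rw [𝒢.inv_mul, h.map_one] at h1
  linarith

/-- The Lie groupoid `Σ ×_r ℝ`, with arrows `Σ × ℝ` and objects `M × ℝ`:
`α(g, s) = (α(g), s)`, `β(g, s) = (β(g), s - r(g))`, `(g₁, s₁) (g₂, s₂) = (g₁ g₂, s₂)`. -/
def twistedProd [IsManifold I ∞ G] [IsManifold J ∞ M] (r : G → ℝ)
    (hr : ContMDiff I 𝓘(ℝ, ℝ) ∞ r) (hm : 𝒢.IsMultiplicativeFun r) :
    LieGroupoid (I.prod 𝓘(ℝ, ℝ)) (J.prod 𝓘(ℝ, ℝ)) (G × ℝ) (M × ℝ) where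
  src p := (𝒢.src p.1, p.2)
  tgt p := (𝒢.tgt p.1, p.2 - r p.1)
  one x := (𝒢.one x.1, x.2)
  inv p := (𝒢.inv p.1, p.2 - r p.1)
  mul p q := (𝒢.mul p.1 q.1, q.2)
  src_one x := by simp [𝒢.src_one]
  tgt_one x := by simp [𝒢.tgt_one, hm.map_one]
  src_mul p q h := by
    simp only [Prod.mk.injEq] at h
    simp [𝒢.src_mul _ _ h.1]
  tgt_mul p q h := by
    simp only [Prod.mk.injEq] at h
    simp [𝒢.tgt_mul _ _ h.1, hm _ _ h.1, h.2]
    ring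
  mul_assoc p q k h h' := by
    simp only [Prod.mk.injEq] at h h'
    simp [𝒢.mul_assoc _ _ _ h.1 h'.1]
  one_mul p := by simp [𝒢.one_mul]
  mul_one p := by simp [𝒢.mul_one]
  src_inv p := by simp [𝒢.src_inv]
  tgt_inv p := by simp [𝒢.tgt_inv, hm.map_inv]
  inv_mul p := by simp [𝒢.inv_mul]
  mul_inv p := by simp [𝒢.mul_inv]
  t2_base := by
    have := 𝒢.t2_base
    infer_instance
  t2_fiber x := by
    have := 𝒢.t2_fiber x.1
    let f : {p : G × ℝ // (𝒢.src p.1, p.2) = x} → {g : G // 𝒢.src g = x.1} :=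
      fun p ↦ ⟨p.1.1, congrArg Prod.fst p.2⟩
    have hf : Continuous f := by fun_prop
    refine T2Space.of_injective_continuous (f := f) (fun p q hpq ↦ ?_) hf
    have h1 : p.1.1 = q.1.1 := congrArg Subtype.val hpq
    have h2 : p.1.2 = q.1.2 := (congrArg Prod.snd p.2).trans (congrArg Prod.snd q.2).symm
    exact Subtype.ext (Prod.ext h1 h2)
  submersion_src := 𝒢.submersion_src.prodMap Manifold.IsSubmersion.id
  submersion_tgt := isSubmersion_comp_diffeomorph
    (𝒢.submersion_tgt.prodMap (Manifold.IsSubmersion.id (M := ℝ))) (shear hr)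
  smooth_one := (𝒢.smooth_one.comp contMDiff_fst).prodMk contMDiff_snd
  smooth_inv := (𝒢.smooth_inv.comp contMDiff_fst).prodMk
    (contMDiff_snd.sub (hr.comp contMDiff_fst))
  smooth_mul := by
    refine ContMDiffOn.prodMk ?_ (contMDiff_snd.comp contMDiff_snd).contMDiffOn
    refine 𝒢.smooth_mul.comp (f := fun q : (G × ℝ) × (G × ℝ) ↦ (q.1.1, q.2.1))
      ((contMDiff_fst.comp contMDiff_fst).prodMk
        (contMDiff_fst.comp contMDiff_snd)).contMDiffOn ?_
    intro q hq
    exact congrArg Prod.fst hq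

end LieGroupoid

/-! ### The correspondence -/

section Correspondence

variable {E : Type*} [NormedAddCommGroup E] [NormedSpace ℝ E]
  {H : Type*} [TopologicalSpace H] (I : ModelWithCorners ℝ E H)
  (G : Type*) [TopologicalSpace G] [ChartedSpace H G]

/-- The vector field `∂/∂s` on `Σ × ℝ`, where `s` is the coordinate on `ℝ`. -/
def partialS : VField (I.prod 𝓘(ℝ, ℝ)) (G × ℝ) := fun _ ↦ ((0, 1) : E × ℝ)

variable {G}

/-- The 1-form `eˢ pr₁^* θ` on `Σ × ℝ`. -/
def expForm (θ : DForm I G 1) : DForm (I.prod 𝓘(ℝ, ℝ)) (G × ℝ) 1 := fun p ↦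
  Real.exp p.2 • DForm.pullback (I.prod 𝓘(ℝ, ℝ)) I (Prod.fst : G × ℝ → G) θ p

/-- The 2-form `d(eˢ pr₁^* θ)` on `Σ × ℝ`. -/
def symplectization (θ : DForm I G 1) : DForm (I.prod 𝓘(ℝ, ℝ)) (G × ℝ) 2 :=
  DForm.d (I.prod 𝓘(ℝ, ℝ)) (expForm I θ)

/-- The restriction of the 1-form `ι_{∂/∂s} Ω` to `Σ = Σ × {0}`. -/
def contactization (Ω : DForm (I.prod 𝓘(ℝ, ℝ)) (G × ℝ) 2) : DForm I G 1 :=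
  DForm.pullback I (I.prod 𝓘(ℝ, ℝ)) (fun g : G ↦ (g, (0 : ℝ)))
    (DForm.contract (I.prod 𝓘(ℝ, ℝ)) (partialS I G) Ω)

end Correspondence

end ContactGroupoid

end

/-! The theorem rests on the formula `d(eˢ θ) = eˢ (ds ∧ θ + dθ)` (`symplectization_apply`), from
which each clause of the definitions can be read off.

Nondegeneracy. The form `ds ∧ θ + dθ` is nondegenerate on `E × ℝ` exactly when `θ ∧ (dθ)ⁿ ≠ 0` with
`dim E = 2 n + 1`. This is pointwise linear algebra (`exists_wedgePow_ne_zero_iff`). In one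
direction, a vector in the kernel of `ds ∧ θ + B` forces the top form to vanish. In the other, a
symplectic basis adapted to `∂/∂s` gives vectors on which the top form is positive. Closedness is `d
∘ d = 0`, so contact corresponds to symplectic (`isContactForm_iff`).

Multiplicativity. On composable pairs `(g, s), (h, t)` one has `s = t - r(h)`. Multiplicativity of
the 1-form `eˢ θ` therefore says `eᵗ m^*θ = e^{t - r(h)} θ_g + eᵗ θ_h`, which is the contact
condition multiplied by `eᵗ` (`expForm_isMultiplicative_iff`). The differential of a multiplicative
1-form is multiplicative (`IsMultiplicativeOneForm.d`). Conversely, contracting `d(eˢ θ)` with the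
multiplicative field `∂/∂s` returns `eˢ θ`, so multiplicativity of the 2-form passes back to the
1-form (`symplectization_isMultiplicative_iff`).

Inverse. If `Ω` is closed and `L_{∂/∂s} Ω = Ω`, then `Ω` at height `s` is `eˢ` times `Ω` at height
`0`, and Cartan's formula gives `Ω = d(ι_{∂/∂s} Ω)`. Hence `Ω` is the symplectization of its
contactization (`symplectization_contactization`). The other composite is the contraction of the
basic formula at `s = 0`.

The analytic work lies in naturality of `d` for forms defined through charts, and in smooth local
parametrizations of the composable pairs. Along these, identities on `Σ₂` become identities on open
sets of a vector space and can be differentiated. -/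

namespace ContactGroupoid

/-! ### Linear algebra: `θ ∧ Bⁿ ≠ 0` versus nondegeneracy of `ds ∧ θ + B`. -/

section LinearAlgebra

variable {V : Type*} [AddCommGroup V] [Module ℝ V]

theorem prod_pairing_update (B : V →ₗ[ℝ] V →ₗ[ℝ] ℝ) {n : ℕ} [DecidableEq (Option (Fin n × Bool))]
    (v : Option (Fin n × Bool) → V) (k : Fin n) (b : Bool) (z : V) :
    ∏ i ∈ ({k} : Finset (Fin n))ᶜ,
      B (update v (some (k, b)) z (some (i, false))) (update v (some (k, b)) z (some (i, true)))
      = ∏ i ∈ ({k} : Finset (Fin n))ᶜ, B (v (some (i, false))) (v (some (i, true))) := by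
  refine Finset.prod_congr rfl fun i hi ↦ ?_
  have hi' : i ≠ k := by simpa using hi
  rw [update_of_ne (by simp [hi']), update_of_ne (by simp [hi'])]

/-- The multilinear map `v ↦ θ (v none) * ∏ i, B (v (i, false)) (v (i, true))`. -/
def pairingMultilinear (θ : V →ₗ[ℝ] ℝ) (B : V →ₗ[ℝ] V →ₗ[ℝ] ℝ) (n : ℕ) :
    MultilinearMap ℝ (fun _ : Option (Fin n × Bool) ↦ V) ℝ where
  toFun v := θ (v none) * ∏ i, B (v (some (i, false))) (v (some (i, true)))
  map_update_add' {_} v j x y := by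
    rcases j with _ | ⟨k, b⟩
    · simp [add_mul]
    · simp only [Fintype.prod_eq_mul_prod_compl k, prod_pairing_update]
      cases b <;> simp <;> ring
  map_update_smul' {_} v j c x := by
    rcases j with _ | ⟨k, b⟩
    · simp [mul_assoc]
    · simp only [Fintype.prod_eq_mul_prod_compl k, prod_pairing_update]
      cases b <;> simp <;> ring

theorem pairingMultilinear_apply (θ : V →ₗ[ℝ] ℝ) (B : V →ₗ[ℝ] V →ₗ[ℝ] ℝ) (n : ℕ)
    (v : Option (Fin n × Bool) → V) :
    pairingMultilinear θ B n v = θ (v none) * ∏ i, B (v (some (i, false))) (v (some (i, true))) :=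
  rfl

/-- The alternating form `2 ^ n • θ ∧ Bⁿ`. -/
def pairingAlternating (θ : V →ₗ[ℝ] ℝ) (B : V →ₗ[ℝ] V →ₗ[ℝ] ℝ) (n : ℕ) :
    V [⋀^Option (Fin n × Bool)]→ₗ[ℝ] ℝ :=
  MultilinearMap.alternatization (pairingMultilinear θ B n)

theorem pairingAlternating_apply (θ : V →ₗ[ℝ] ℝ) (B : V →ₗ[ℝ] V →ₗ[ℝ] ℝ) (n : ℕ)
    (v : Option (Fin n × Bool) → V) :
    pairingAlternating θ B n v = ∑ π : Equiv.Perm (Option (Fin n × Bool)),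
      ((Equiv.Perm.sign π : ℤ) : ℝ) * pairingMultilinear θ B n (v ∘ π) := by
  rw [pairingAlternating, MultilinearMap.alternatization_apply]
  refine Finset.sum_congr rfl fun π _ ↦ ?_
  simp only [MultilinearMap.domDomCongr_apply, Units.smul_def, zsmul_eq_mul]
  rfl

/-- As `B (v (k, b))` is `a θ`, the factor `θ` times the `k`-th factor `B` equals `± a θ(x) θ(y)`,
where `x` sits in the slot of `θ` and `y` in the slot paired with `(k, b)`. This is symmetric in `x`
and `y`. -/
theorem pairingMultilinear_swap {θ : V →ₗ[ℝ] ℝ} {B : V →ₗ[ℝ] V →ₗ[ℝ] ℝ} (hB : B.IsAlt) {n : ℕ}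
    {a : ℝ} (k : Fin n) (b : Bool) (v : Option (Fin n × Bool) → V)
    (h : ∀ w, B (v (some (k, b))) w = a * θ w) :
    pairingMultilinear θ B n (v ∘ Equiv.swap none (some (k, !b))) = pairingMultilinear θ B n v := by
  simp only [pairingMultilinear_apply, Fintype.prod_eq_mul_prod_compl k, comp_apply,
    Equiv.swap_apply_left]
  have hp : ∏ i ∈ ({k} : Finset (Fin n))ᶜ,
      B (v (Equiv.swap none (some (k, !b)) (some (i, false))))
        (v (Equiv.swap none (some (k, !b)) (some (i, true))))
      = ∏ i ∈ ({k} : Finset (Fin n))ᶜ, B (v (some (i, false))) (v (some (i, true))) := by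
    refine Finset.prod_congr rfl fun i hi ↦ ?_
    have hi' : i ≠ k := by simpa using hi
    rw [Equiv.swap_apply_of_ne_of_ne (by simp) (by simp [hi']),
      Equiv.swap_apply_of_ne_of_ne (by simp) (by simp [hi'])]
  rw [hp, ← mul_assoc, ← mul_assoc]
  congr 1
  cases b
  · simp only [Bool.not_false, Equiv.swap_apply_right]
    rw [Equiv.swap_apply_of_ne_of_ne (by simp) (by simp), h, h]
    ring
  · simp only [Bool.not_true, Equiv.swap_apply_right]
    rw [Equiv.swap_apply_of_ne_of_ne (by simp) (by simp), ← hB.neg, h, ← hB.neg, h]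
    ring

/-- For `u = v j` this is `ι_u (θ ∧ Bⁿ) = θ(u) Bⁿ - n θ ∧ ι_u B ∧ Bⁿ⁻¹ = 0`, because `θ(u) = 0` and
`θ ∧ θ = 0`. In the sum over permutations, the terms with `u` in the slot of `θ` vanish. The others
cancel in pairs under the transposition of `pairingMultilinear_swap`. -/
theorem pairingAlternating_eq_zero {θ : V →ₗ[ℝ] ℝ} {B : V →ₗ[ℝ] V →ₗ[ℝ] ℝ} (hB : B.IsAlt) {n : ℕ}
    {a : ℝ} (v : Option (Fin n × Bool) → V) (j : Option (Fin n × Bool)) (hθ : θ (v j) = 0)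
    (h : ∀ w, B (v j) w = a * θ w) : pairingAlternating θ B n v = 0 := by
  rw [pairingAlternating_apply]
  let ptn : Option (Fin n × Bool) → Option (Fin n × Bool) := Option.map fun p ↦ (p.1, !p.2)
  -- The transposition leaves the slot that holds `j` in place, so performing the operation twice
  -- uses the same transposition: it is an involution.
  have hinv : ∀ π : Equiv.Perm (Option (Fin n × Bool)), π.symm j ≠ none →
      (π * Equiv.swap none (ptn (π.symm j))).symm j = π.symm j := by
    intro π hπ
    rw [Equiv.symm_apply_eq, Equiv.Perm.mul_apply, Equiv.swap_apply_of_ne_of_ne hπ]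
    · simp
    · obtain ⟨⟨k, b⟩, hk⟩ := Option.ne_none_iff_exists'.1 hπ
      rw [hk]
      simp [ptn]
  refine Finset.sum_involution
    (fun π _ ↦ if π.symm j = none then π else π * Equiv.swap none (ptn (π.symm j))) ?_ ?_
    (fun _ _ ↦ Finset.mem_univ _) ?_
  · intro π _
    split_ifs with hπ
    · have : π none = j := by rw [← hπ]; simp
      simp [pairingMultilinear_apply, this, hθ]
    · obtain ⟨⟨k, b⟩, hk⟩ := Option.ne_none_iff_exists'.1 hπ
      have hj : π (some (k, b)) = j := by rw [← hk]; simp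
      have h1 : pairingMultilinear θ B n (v ∘ ⇑(π * Equiv.swap none (ptn (π.symm j)))) =
          pairingMultilinear θ B n (v ∘ π) := by
        rw [hk]
        exact pairingMultilinear_swap hB k b (v ∘ π) (a := a) (by simpa [hj] using h)
      rw [h1, Equiv.Perm.sign_mul, Equiv.Perm.sign_swap (by rw [hk]; simp [ptn])]
      simp
  · intro π _ hne heq
    split_ifs at heq with hπ
    · have : π none = j := by rw [← hπ]; simp
      simp [pairingMultilinear_apply, this, hθ] at hne
    · obtain ⟨⟨k, b⟩, hk⟩ := Option.ne_none_iff_exists'.1 hπ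
      rw [mul_eq_left, Equiv.swap_eq_one_iff, hk] at heq
      simp [ptn] at heq
  · intro π _
    by_cases hπ : π.symm j = none
    · simp [hπ]
    · simp only [hπ, if_false]
      rw [hinv π hπ]
      simp only [hπ, if_false]
      rw [mul_assoc, Equiv.swap_mul_self, mul_one]

/-- If `θ ∧ Bⁿ ≠ 0` in dimension `2 n + 1`, the form `ds ∧ θ + B` is nondegenerate. -/
theorem eq_zero_of_pairingAlternating_ne_zero [FiniteDimensional ℝ V] {θ : V →ₗ[ℝ] ℝ}
    {B : V →ₗ[ℝ] V →ₗ[ℝ] ℝ} (hB : B.IsAlt) {n : ℕ} (hn : Module.finrank ℝ V = 2 * n + 1)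
    {v : Option (Fin n × Bool) → V} (hv : pairingAlternating θ B n v ≠ 0) {u : V} {a : ℝ}
    (hu : θ u = 0) (h : ∀ w, a * θ w + B u w = 0) : u = 0 ∧ a = 0 := by
  have hli : LinearIndependent ℝ v := by
    by_contra hc
    exact hv (AlternatingMap.map_linearDependent _ v hc)
  have hcard : Fintype.card (Option (Fin n × Bool)) = Module.finrank ℝ V := by
    simp [hn, mul_comm]
  let b := basisOfLinearIndependentOfCardEqFinrank hli hcard
  have hb : ∀ i, b i = v i := fun i ↦ by simp [b]
  -- Replacing `v j` by `u` multiplies the top form by the `j`-th coordinate of `u`, and it also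
  -- gives `0` since `B u = -a θ`.
  have hu0 : u = 0 := by
    refine b.ext_elem fun j ↦ ?_
    have h1 : pairingAlternating θ B n (update v j u) = 0 :=
      pairingAlternating_eq_zero hB (a := -a) _ j (by simpa using hu)
        (fun w ↦ by simp only [update_self]; linarith [h w])
    have h2 : pairingAlternating θ B n (update v j u) = b.repr u j * pairingAlternating θ B n v := by
      conv_lhs => rw [← b.sum_repr u]
      rw [AlternatingMap.map_update_sum, Finset.sum_eq_single j]
      · rw [AlternatingMap.map_update_smul, hb, update_eq_self, smul_eq_mul]
      · intro i _ hi
        rw [AlternatingMap.map_update_smul, hb, AlternatingMap.map_update_self _ _ hi.symm,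
          smul_zero]
      · simp
    rw [h1] at h2
    have := (mul_eq_zero.1 h2.symm).resolve_right hv
    simpa using this
  refine ⟨hu0, ?_⟩
  -- With `u = 0` and `a ≠ 0` the hypothesis gives `θ = 0`, so every term of the sum vanishes.
  by_contra ha
  refine hv ?_
  rw [pairingAlternating_apply]
  refine Finset.sum_eq_zero fun π _ ↦ ?_
  have : θ (v (π none)) = 0 := by simpa [hu0, ha] using h (v (π none))
  simp [pairingMultilinear_apply, this]

/-- The relations of a symplectic basis. -/
def IsSymplecticFamily (B : V →ₗ[ℝ] V →ₗ[ℝ] ℝ) {n : ℕ} (w : Fin n × Bool → V) : Prop :=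
  ∀ i j b c, B (w (i, b)) (w (j, c)) = if i = j ∧ c = !b then (if b then -1 else 1) else 0

/-- Splits off a hyperbolic plane containing the given vector: `f` is scaled so that `B e f = 1`,
and `W` is the `B`-orthogonal of `e` and `f`, the kernel of a surjection onto `ℝ × ℝ`. -/
theorem exists_symplectic_complement [FiniteDimensional ℝ V] {B : V →ₗ[ℝ] V →ₗ[ℝ] ℝ}
    (hB : B.IsAlt) (hnd : ∀ u, (∀ v, B u v = 0) → u = 0) {e : V} (he : e ≠ 0) :
    ∃ (f : V) (W : Submodule ℝ V), B e f = 1 ∧ Module.finrank ℝ V = Module.finrank ℝ W + 2 ∧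
      (∀ x ∈ W, B e x = 0 ∧ B f x = 0) ∧ ∀ u ∈ W, (∀ v ∈ W, B u v = 0) → u = 0 := by
  have h1 : ∃ f, B e f ≠ 0 := by
    by_contra! hc
    exact he (hnd e hc)
  obtain ⟨f₀, hf₀⟩ := h1
  let f := (B e f₀)⁻¹ • f₀
  have hef : B e f = 1 := by simp [f, hf₀]
  have hfe : B f e = -1 := by rw [← hB.neg, hef]
  have hee : B e e = 0 := hB e
  have hff : B f f = 0 := hB f
  let L : V →ₗ[ℝ] ℝ × ℝ := (B e).prod (B f)
  refine ⟨f, LinearMap.ker L, hef, ?_, ?_, ?_⟩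
  · have hs : LinearMap.range L = ⊤ := by
      rw [LinearMap.range_eq_top]
      rintro ⟨x, y⟩
      refine ⟨x • f - y • e, ?_⟩
      simp [L, hef, hfe, hee, hff]
    have := LinearMap.finrank_range_add_finrank_ker L
    rw [hs, finrank_top, Module.finrank_prod, Module.finrank_self] at this
    omega
  · intro x hx
    simpa [L] using hx
  · intro u hu hW
    have hu' : B e u = 0 ∧ B f u = 0 := by simpa [L] using hu
    have hue : B u e = 0 := by rw [← hB.neg, hu'.1, neg_zero]
    have huf : B u f = 0 := by rw [← hB.neg, hu'.2, neg_zero]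
    refine hnd u fun x ↦ ?_
    -- The argument is the projection of `x` to `W` along the plane of `e` and `f`; `u` is
    -- orthogonal to that plane.
    have h2 := hW (x + B f x • e - B e x • f) (by simp [L, hef, hfe, hee, hff])
    simpa [hue, huf] using h2

/-- Hyperbolic planes are split off one at a time. The dimension drops by two and the space changes,
so the induction is on an upper bound for the dimension, with the space quantified inside. -/
theorem exists_symplecticFamily (n : ℕ) : ∀ {V : Type _} [AddCommGroup V] [Module ℝ V]
    [FiniteDimensional ℝ V] {B : V →ₗ[ℝ] V →ₗ[ℝ] ℝ} (_ : B.IsAlt)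
    (_ : ∀ u, (∀ v, B u v = 0) → u = 0) (_ : Module.finrank ℝ V ≤ n),
    ∃ (k : ℕ) (w : Fin k × Bool → V), Module.finrank ℝ V = 2 * k ∧ IsSymplecticFamily B w := by
  induction n with
  | zero =>
    intro V _ _ _ B hB hnd hV
    exact ⟨0, fun p ↦ p.1.elim0, by omega, fun i ↦ i.elim0⟩
  | succ n ih =>
    intro V _ _ _ B hB hnd hV
    by_cases h0 : Module.finrank ℝ V = 0
    · exact ⟨0, fun p ↦ p.1.elim0, by omega, fun i ↦ i.elim0⟩
    obtain ⟨e, he⟩ : ∃ e : V, e ≠ 0 := by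
      by_contra! hc
      exact h0 (finrank_zero_iff_forall_zero.2 hc)
    obtain ⟨f, W, hef, hfr, hW, hWnd⟩ := exists_symplectic_complement hB hnd he
    obtain ⟨k, w, hk, hw⟩ := ih (V := W) (B := B.domRestrict₁₂ W W) (fun x ↦ hB x)
      (fun u hu ↦ Subtype.ext (hWnd u u.2 fun v hv ↦ hu ⟨v, hv⟩)) (by omega)
    refine ⟨k + 1, fun p ↦ Fin.cases (if p.2 then f else e) (fun i ↦ (w (i, p.2) : V)) p.1,
      by omega, ?_⟩
    have hB' : ∀ x y : V, B x y = 0 → B y x = 0 := fun x y h ↦ by rw [← hB.neg, h, neg_zero]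
    intro i j b c
    refine Fin.cases ?_ (fun i ↦ ?_) i <;> refine Fin.cases ?_ (fun j ↦ ?_) j
    · have hfe : B f e = -1 := by rw [← hB.neg, hef]
      have hee : B e e = 0 := hB e
      have hff : B f f = 0 := hB f
      cases b <;> cases c <;> simp [hef, hfe, hee, hff]
    · have := hW _ (w (j, c)).2
      cases b <;> simp [this, (Fin.succ_ne_zero _).symm]
    · have := hW _ (w (i, b)).2
      cases c <;> simp [hB' _ _ this.1, hB' _ _ this.2, Fin.succ_ne_zero]
    · have : B (w (i, b)) (w (j, c)) = _ := hw i j b c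
      simpa using this

/-- There is no cancellation. A nonzero term requires `π` to fix `none` and to carry pairs to pairs,
so `π` is a permutation `τ` of the pairs combined with flips inside some of them. `τ` acts on both
members of the pairs and is even in total; each flip changes both the sign of `π` and the sign of
one factor `B`. -/
theorem pairingMultilinear_nonneg {θ : V →ₗ[ℝ] ℝ} {B : V →ₗ[ℝ] V →ₗ[ℝ] ℝ} {n : ℕ}
    {w : Fin n × Bool → V} (hw : IsSymplecticFamily B w) (hθ : ∀ p, θ (w p) = 0) {x : V}
    (hx : θ x = 1) (π : Equiv.Perm (Option (Fin n × Bool))) :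
    0 ≤ ((Equiv.Perm.sign π : ℤ) : ℝ) *
      pairingMultilinear θ B n ((fun o ↦ Option.elim o x w) ∘ π) := by
  by_cases h0 : pairingMultilinear θ B n ((fun o ↦ Option.elim o x w) ∘ π) = 0
  · rw [h0, mul_zero]
  rw [pairingMultilinear_apply] at h0 ⊢
  simp only [comp_apply] at h0 ⊢
  obtain ⟨h1, h2⟩ := mul_ne_zero_iff.1 h0
  have hnone : π none = none := by
    rcases h : π none with _ | p
    · rfl
    · simp [h, hθ] at h1
  have hsome : ∀ p, ∃ q, π (some p) = some q := by
    intro p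
    refine Option.ne_none_iff_exists'.1 fun h ↦ ?_
    have := π.injective (h.trans hnone.symm)
    simp at this
  choose ρ₀ hρ₀ using hsome
  rw [Finset.prod_ne_zero_iff] at h2
  have h3 : ∀ i, ρ₀ (i, true) = ((ρ₀ (i, false)).1, !(ρ₀ (i, false)).2) := by
    intro i
    have := h2 i (Finset.mem_univ _)
    simp only [hρ₀, Option.elim_some] at this
    rw [show ρ₀ (i, false) = ((ρ₀ (i, false)).1, (ρ₀ (i, false)).2) from rfl,
      show ρ₀ (i, true) = ((ρ₀ (i, true)).1, (ρ₀ (i, true)).2) from rfl, hw] at this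
    have h4 := (ite_ne_right_iff.1 this).1
    exact Prod.ext h4.1.symm h4.2
  have hinj : Injective ρ₀ := by
    intro p q hpq
    have := π.injective ((hρ₀ p).trans ((congrArg some hpq).trans (hρ₀ q).symm))
    simpa using this
  -- Two different pairs with the same image would give `ρ₀ (i, false) = ρ₀ (j, true)`, against
  -- injectivity.
  have hτ : Injective fun i ↦ (ρ₀ (i, false)).1 := by
    intro i j hij
    simp only at hij
    by_cases hb : (ρ₀ (i, false)).2 = (ρ₀ (j, false)).2
    · exact congrArg Prod.fst (hinj (Prod.ext hij hb))
    · have : ρ₀ (i, false) = ρ₀ (j, true) := by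
        rw [h3]
        refine Prod.ext hij ?_
        simpa [Bool.eq_not] using hb
      exact congrArg Prod.fst (hinj this)
  let τ : Equiv.Perm (Fin n) := Equiv.ofBijective _ (Finite.injective_iff_bijective.1 hτ)
  let s : Fin n → Equiv.Perm Bool := fun i ↦
    if (ρ₀ (i, false)).2 then Equiv.swap false true else 1
  let ρ : Equiv.Perm (Fin n × Bool) :=
    Equiv.prodCongrLeft (fun _ : Bool ↦ τ) * Equiv.prodCongrRight s
  have hρ : π = Equiv.optionCongr ρ := by
    refine Equiv.ext fun o ↦ ?_
    rcases o with _ | ⟨i, b⟩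
    · simp [hnone]
    · rw [hρ₀]
      simp only [Equiv.optionCongr_apply, Option.map_some, Option.some.injEq, ρ,
        Equiv.Perm.mul_apply, Equiv.prodCongrRight_apply, Equiv.prodCongrLeft_apply]
      cases b
      · refine Prod.ext rfl ?_
        simp only [s]
        split_ifs with hs <;> simp [hs]
      · rw [h3]
        refine Prod.ext rfl ?_
        simp only [s]
        split_ifs with hs <;> simp [hs]
  have hsign : Equiv.Perm.sign π = ∏ i, Equiv.Perm.sign (s i) := by
    rw [hρ, Equiv.optionCongr_sign, Equiv.Perm.sign_mul, Equiv.Perm.sign_prodCongrLeft,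
      Equiv.Perm.sign_prodCongrRight]
    simp
  have hval : ∀ i, B (Option.elim (π (some (i, false))) x w) (Option.elim (π (some (i, true))) x w)
      = ((Equiv.Perm.sign (s i) : ℤ) : ℝ) := by
    intro i
    simp only [hρ₀, Option.elim_some]
    rw [h3, show ρ₀ (i, false) = ((ρ₀ (i, false)).1, (ρ₀ (i, false)).2) from rfl, hw]
    simp only [s]
    split_ifs <;> simp_all
  rw [hnone, Option.elim_none, hx, one_mul, hsign, Finset.prod_congr rfl fun i _ ↦ hval i]
  push_cast
  rw [← Finset.prod_mul_distrib]
  exact Finset.prod_nonneg fun i _ ↦ mul_self_nonneg _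

theorem pairingAlternating_pos {θ : V →ₗ[ℝ] ℝ} {B : V →ₗ[ℝ] V →ₗ[ℝ] ℝ} {n : ℕ}
    {w : Fin n × Bool → V} (hw : IsSymplecticFamily B w) (hθ : ∀ p, θ (w p) = 0) {x : V}
    (hx : θ x = 1) : 0 < pairingAlternating θ B n fun o ↦ Option.elim o x w := by
  rw [pairingAlternating_apply]
  refine Finset.sum_pos' (fun π _ ↦ pairingMultilinear_nonneg hw hθ hx π)
    ⟨1, Finset.mem_univ _, ?_⟩
  have : ∀ i, B (w (i, false)) (w (i, true)) = 1 := fun i ↦ by rw [hw]; simp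
  simp [pairingMultilinear_apply, this, hx]

/-- The form `((u, a), (v, b)) ↦ a θ(v) - b θ(u) + B(u, v)`. -/
def symplecticSuspension (θ : V →ₗ[ℝ] ℝ) (B : V →ₗ[ℝ] V →ₗ[ℝ] ℝ) :
    (V × ℝ) →ₗ[ℝ] (V × ℝ) →ₗ[ℝ] ℝ :=
  LinearMap.mk₂ ℝ (fun p q ↦ p.2 * θ q.1 - q.2 * θ p.1 + B p.1 q.1)
    (fun p p' q ↦ by simp; ring) (fun c p q ↦ by simp; ring)
    (fun p q q' ↦ by simp; ring) (fun c p q ↦ by simp; ring)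

/-- The suspension is symplectic on `V × ℝ`. Take the hyperbolic plane through `(0, 1)` with partner
`f`: as `Ω (0, 1) q = θ q.1`, the complement `W` projects into `ker θ` and `θ f.1 = 1`. On `ker θ`
the suspension reduces to `B`, so a symplectic basis of `W` projects to a symplectic family for `B`.
-/
theorem exists_pairingAlternating_ne_zero [FiniteDimensional ℝ V] {θ : V →ₗ[ℝ] ℝ}
    {B : V →ₗ[ℝ] V →ₗ[ℝ] ℝ} (hB : B.IsAlt)
    (h : ∀ (u : V) (a : ℝ), θ u = 0 → (∀ w, a * θ w + B u w = 0) → u = 0 ∧ a = 0) :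
    ∃ n, Module.finrank ℝ V = 2 * n + 1 ∧ ∃ v, pairingAlternating θ B n v ≠ 0 := by
  let Ω := symplecticSuspension θ B
  have hΩ : ∀ p q, Ω p q = p.2 * θ q.1 - q.2 * θ p.1 + B p.1 q.1 := fun p q ↦ rfl
  have hΩalt : Ω.IsAlt := fun p ↦ by rw [hΩ, hB p.1]; ring
  have hnd : ∀ p, (∀ q, Ω p q = 0) → p = 0 := by
    intro p hp
    have h1 : θ p.1 = 0 := by simpa [hΩ] using hp (0, 1)
    obtain ⟨h2, h3⟩ := h p.1 p.2 h1 fun w ↦ by simpa [hΩ] using hp (w, 0)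
    exact Prod.ext h2 h3
  obtain ⟨f, W, hef, hfr, hW, hWnd⟩ :=
    exists_symplectic_complement hΩalt hnd (e := ((0, 1) : V × ℝ)) (by simp)
  obtain ⟨k, w, hk, hw⟩ := exists_symplecticFamily (Module.finrank ℝ W) (V := W)
    (B := Ω.domRestrict₁₂ W W) (fun x ↦ hΩalt x)
    (fun u hu ↦ Subtype.ext (hWnd u u.2 fun v hv ↦ hu ⟨v, hv⟩)) le_rfl
  have hθ : ∀ p, θ (w p : V × ℝ).1 = 0 := fun p ↦ by
    simpa [hΩ] using (hW _ (w p).2).1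
  refine ⟨k, ?_, _, (pairingAlternating_pos (w := fun p ↦ (w p : V × ℝ).1) (x := f.1) ?_ hθ ?_).ne'⟩
  · rw [Module.finrank_prod, Module.finrank_self] at hfr
    omega
  · intro i j b c
    have : Ω (w (i, b)) (w (j, c)) = _ := hw i j b c
    rw [← this]
    simp [hΩ, hθ]
  · simpa [hΩ] using hef

end LinearAlgebra

/-! ### Translation of the linear algebra to `wedgePow`. -/

section WedgePow

variable {E : Type*} [NormedAddCommGroup E] [NormedSpace ℝ E]

/-- An alternating 1-form as a linear map. -/
def formToLinear (θ : E [⋀^Fin 1]→L[ℝ] ℝ) : E →ₗ[ℝ] ℝ where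
  toFun u := θ ![u]
  map_add' u v := θ.map_vecCons_add ![] u v
  map_smul' c u := θ.map_vecCons_smul ![] c u

@[simp]
theorem formToLinear_apply (θ : E [⋀^Fin 1]→L[ℝ] ℝ) (u : E) : formToLinear θ u = θ ![u] := rfl

/-- An alternating 2-form as a bilinear map. -/
def formToBilin (σ : E [⋀^Fin 2]→L[ℝ] ℝ) : E →ₗ[ℝ] E →ₗ[ℝ] ℝ :=
  LinearMap.mk₂ ℝ (fun u v ↦ σ ![u, v]) (fun u u' v ↦ σ.map_vecCons_add ![v] u u')
    (fun c u v ↦ σ.map_vecCons_smul ![v] c u)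
    (fun u v v' ↦ (σ.curryLeft u).map_vecCons_add ![] v v')
    (fun c u v ↦ (σ.curryLeft u).map_vecCons_smul ![] c v)

@[simp]
theorem formToBilin_apply (σ : E [⋀^Fin 2]→L[ℝ] ℝ) (u v : E) :
    formToBilin σ u v = σ ![u, v] := rfl

theorem formToBilin_isAlt (σ : E [⋀^Fin 2]→L[ℝ] ℝ) : (formToBilin σ).IsAlt := fun u ↦
  σ.map_eq_zero_of_eq ![u, u] (i := 0) (j := 1) (by simp) (by simp)

/-- The numbering of the arguments used in `wedgePow`. -/
noncomputable def pairIndex (n : ℕ) : Option (Fin n × Bool) ≃ Fin (2 * n + 1) :=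
  Equiv.ofBijective
    (fun o ↦ o.elim 0 fun p ↦
      if p.2 then ⟨2 * p.1.val + 2, by omega⟩ else ⟨2 * p.1.val + 1, by omega⟩) <| by
    rw [Fintype.bijective_iff_injective_and_card]
    refine ⟨?_, by simp [mul_comm]⟩
    rintro (_ | ⟨i, _ | _⟩) (_ | ⟨j, _ | _⟩) h <;> simp [Fin.ext_iff] at h ⊢ <;> omega

theorem wedgePow_eq (θ : E [⋀^Fin 1]→L[ℝ] ℝ) (σ : E [⋀^Fin 2]→L[ℝ] ℝ) (n : ℕ)
    (v : Fin (2 * n + 1) → E) : wedgePow θ σ n v =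
      ((2 : ℝ) ^ n)⁻¹ * pairingAlternating (formToLinear θ) (formToBilin σ) n
        (v ∘ pairIndex n) := by
  rw [wedgePow, pairingAlternating_apply]
  congr 1
  refine (Fintype.sum_equiv (Equiv.permCongr (pairIndex n)) _ _ fun π ↦ ?_).symm
  rw [Equiv.Perm.sign_permCongr, pairingMultilinear_apply]
  have h0 : (pairIndex n).symm 0 = none := by
    rw [Equiv.symm_apply_eq]; rfl
  have h1 : ∀ i : Fin n, (pairIndex n).symm ⟨2 * i.val + 1, by omega⟩ = some (i, false) := by
    intro i
    rw [Equiv.symm_apply_eq]; rfl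
  have h2 : ∀ i : Fin n, (pairIndex n).symm ⟨2 * i.val + 2, by omega⟩ = some (i, true) := by
    intro i
    rw [Equiv.symm_apply_eq]; rfl
  simp [Equiv.permCongr_apply, h0, h1, h2]

/-- The condition `θ ∧ σⁿ ≠ 0` in dimension `2 n + 1`, expressed by the nondegeneracy of
`ds ∧ θ + σ`. -/
theorem exists_wedgePow_ne_zero_iff [FiniteDimensional ℝ E] (θ : E [⋀^Fin 1]→L[ℝ] ℝ)
    (σ : E [⋀^Fin 2]→L[ℝ] ℝ) :
    (∃ n : ℕ, Module.finrank ℝ E = 2 * n + 1 ∧ ∃ v : Fin (2 * n + 1) → E, wedgePow θ σ n v ≠ 0) ↔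
      ∀ (u : E) (a : ℝ), θ ![u] = 0 → (∀ w, a * θ ![w] + σ ![u, w] = 0) → u = 0 ∧ a = 0 := by
  constructor
  · rintro ⟨n, hn, v, hv⟩ u a hu h
    rw [wedgePow_eq] at hv
    exact eq_zero_of_pairingAlternating_ne_zero (formToBilin_isAlt σ) hn
      (right_ne_zero_of_mul hv) hu h
  · intro h
    obtain ⟨n, hn, v, hv⟩ := exists_pairingAlternating_ne_zero (θ := formToLinear θ)
      (formToBilin_isAlt σ) h
    refine ⟨n, hn, v ∘ (pairIndex n).symm, ?_⟩
    rw [wedgePow_eq]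
    refine mul_ne_zero (by positivity) ?_
    simpa [comp_assoc] using hv

end WedgePow

/-! ### Pullbacks to vector spaces and naturality of the exterior derivative. -/

section Forms

variable {E : Type*} [NormedAddCommGroup E] [NormedSpace ℝ E]
  {H : Type*} [TopologicalSpace H] {I : ModelWithCorners ℝ E H}
  {X : Type*} [TopologicalSpace X] [ChartedSpace H X] {k : ℕ}
  {W : Type*} [NormedAddCommGroup W] [NormedSpace ℝ W]

/-- All tangent spaces are the model space `E`, so the base point can be replaced while the vectors
stay as they are. -/
theorem DForm.apply_congr (Ω : DForm I X k) {p q : X} (h : p = q) (v : Fin k → E) :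
    Ω p v = Ω q v := by
  subst h; rfl

/-- The pullback of a form to a normed space. -/
noncomputable def DForm.pullbackVec (Ω : DForm I X k) (f : W → X) (w : W) : W [⋀^Fin k]→L[ℝ] ℝ :=
  ContinuousAlternatingMap.compContinuousLinearMap (Ω (f w)) (mfderiv 𝓘(ℝ, W) I f w)

theorem DForm.pullbackVec_apply (Ω : DForm I X k) (f : W → X) (w : W) (v : Fin k → W) :
    DForm.pullbackVec Ω f w v = Ω (f w) (fun i ↦ mfderiv 𝓘(ℝ, W) I f w (v i)) := rfl

theorem DForm.pullbackVec_apply_one (Ω : DForm I X 1) (f : W → X) (w z : W) :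
    DForm.pullbackVec Ω f w ![z] = Ω (f w) ![mfderiv 𝓘(ℝ, W) I f w z] := by
  rw [DForm.pullbackVec_apply]
  congr 1
  funext i
  fin_cases i
  rfl

theorem DForm.pullbackVec_apply_two (Ω : DForm I X 2) (f : W → X) (w z z' : W) :
    DForm.pullbackVec Ω f w ![z, z'] =
      Ω (f w) ![mfderiv 𝓘(ℝ, W) I f w z, mfderiv 𝓘(ℝ, W) I f w z'] := by
  rw [DForm.pullbackVec_apply]
  congr 1
  funext i
  fin_cases i <;> rfl

theorem DForm.IsSmooth.contDiffAt [I.Boundaryless] {Ω : DForm I X k} (hΩ : DForm.IsSmooth I Ω) {x : X} {y : E}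
    (hy : y ∈ (extChartAt I x).target) : ContDiffAt ℝ ∞ (DForm.inChart I Ω x) y :=
  (hΩ x).contDiffAt ((isOpen_extChartAt_target x).mem_nhds hy)

variable [IsManifold I ∞ X]

theorem mfderiv_extChartAt_self_apply (x : X) (v : E) :
    mfderiv I 𝓘(ℝ, E) (extChartAt I x) x v = v := by
  rw [mfderiv_extChartAt_self]; rfl

theorem contDiffAt_extChartAt_comp {f : W → X} {w : W} {x : X}
    (hf : ContMDiffAt 𝓘(ℝ, W) I ∞ f w) (hx : f w ∈ (chartAt H x).source) :
    ContDiffAt ℝ ∞ (extChartAt I x ∘ f) w :=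
  ((contMDiffAt_extChartAt' hx).comp w hf).contDiffAt

theorem DForm.d_apply (Ω : DForm I X k) (x : X) (v : Fin (k + 1) → E) :
    DForm.d I Ω x v = extDeriv (DForm.inChart I Ω x) (extChartAt I x x) v := by
  simp only [DForm.d]
  change extDeriv (DForm.inChart I Ω x) (extChartAt I x x)
    (fun i ↦ mfderiv I 𝓘(ℝ, E) (extChartAt I x) x (v i)) = _
  simp only [mfderiv_extChartAt_self_apply]

theorem eventually_contMDiffAt_one {f : W → X} {w : W} (hf : ContMDiffAt 𝓘(ℝ, W) I ∞ f w) :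
    ∀ᶠ w' in 𝓝 w, ContMDiffAt 𝓘(ℝ, W) I 1 f w' :=
  (contMDiffAt_iff_contMDiffAt_nhds (by simp)).1 (hf.of_le (by simp))

variable [I.Boundaryless]

theorem mfderiv_symm_mfderiv_extChartAt {x p : X} (hp : p ∈ (chartAt H x).source) (v : E) :
    mfderiv 𝓘(ℝ, E) I (extChartAt I x).symm (extChartAt I x p)
      (mfderiv I 𝓘(ℝ, E) (extChartAt I x) p v) = v := by
  have h := mfderivWithin_extChartAt_symm_comp_mfderiv_extChartAt' (I := I) (x := x) (y := p)
    (by rwa [extChartAt_source])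
  rw [I.range_eq_univ, mfderivWithin_univ] at h
  exact congrArg (fun L : E →L[ℝ] E ↦ L v) h

theorem mfderiv_mfderiv_symm_extChartAt {x : X} {y : E} (hy : y ∈ (extChartAt I x).target) (v : E) :
    mfderiv I 𝓘(ℝ, E) (extChartAt I x) ((extChartAt I x).symm y)
      (mfderiv 𝓘(ℝ, E) I (extChartAt I x).symm y v) = v := by
  have h := mfderiv_extChartAt_comp_mfderivWithin_extChartAt_symm (I := I) hy
  rw [I.range_eq_univ, mfderivWithin_univ] at h
  exact congrArg (fun L : E →L[ℝ] E ↦ L v) h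

theorem mfderiv_extChartAt_symm_self_apply (x : X) (v : E) :
    mfderiv 𝓘(ℝ, E) I (extChartAt I x).symm (extChartAt I x x) v = v := by
  have h := mfderiv_symm_mfderiv_extChartAt (I := I) (mem_chart_source H x) v
  rwa [mfderiv_extChartAt_self_apply] at h

theorem contMDiffAt_extChartAt_symm {x : X} {y : E} (hy : y ∈ (extChartAt I x).target) :
    ContMDiffAt 𝓘(ℝ, E) I ∞ (extChartAt I x).symm y :=
  (contMDiffOn_extChartAt_symm x).contMDiffAt ((isOpen_extChartAt_target x).mem_nhds hy)

theorem DForm.inChart_self_apply (Ω : DForm I X k) (x : X) (v : Fin k → E) :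
    DForm.inChart I Ω x (extChartAt I x x) v = Ω x v := by
  change Ω ((extChartAt I x).symm (extChartAt I x x)) (fun i ↦
    mfderiv 𝓘(ℝ, E) I (extChartAt I x).symm (extChartAt I x x) (v i)) = _
  simp only [mfderiv_extChartAt_symm_self_apply]
  exact DForm.apply_congr Ω (extChartAt_to_inv x) v

/-- The pullback of a form, in terms of its expression in a chart. -/
theorem DForm.pullbackVec_eq_inChart (Ω : DForm I X k) {f : W → X} {w : W} (x : X)
    (hf : MDifferentiableAt 𝓘(ℝ, W) I f w) (hx : f w ∈ (chartAt H x).source) :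
    DForm.pullbackVec Ω f w = (DForm.inChart I Ω x (extChartAt I x (f w))).compContinuousLinearMap
      (fderiv ℝ (extChartAt I x ∘ f) w) := by
  ext v
  change Ω (f w) (fun i ↦ mfderiv 𝓘(ℝ, W) I f w (v i)) =
    Ω ((extChartAt I x).symm (extChartAt I x (f w))) (fun i ↦
      mfderiv 𝓘(ℝ, E) I (extChartAt I x).symm (extChartAt I x (f w))
        (fderiv ℝ (extChartAt I x ∘ f) w (v i)))
  have h1 : ∀ u : W, fderiv ℝ (extChartAt I x ∘ f) w u =
      mfderiv I 𝓘(ℝ, E) (extChartAt I x) (f w) (mfderiv 𝓘(ℝ, W) I f w u) := by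
    intro u
    rw [← mfderiv_eq_fderiv, mfderiv_comp w (mdifferentiableAt_extChartAt hx) hf]
    rfl
  have h2 : ∀ u : W, mfderiv 𝓘(ℝ, E) I (extChartAt I x).symm (extChartAt I x (f w))
        (fderiv ℝ (extChartAt I x ∘ f) w u) = mfderiv 𝓘(ℝ, W) I f w u := fun u ↦ by
    rw [h1]
    exact mfderiv_symm_mfderiv_extChartAt hx _
  simp only [h2]
  refine DForm.apply_congr Ω ?_ _
  exact ((extChartAt I x).left_inv (by rwa [extChartAt_source])).symm

theorem DForm.pullbackVec_eventuallyEq (Ω : DForm I X k) {f : W → X} {w : W} {x : X}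
    (hf : ContMDiffAt 𝓘(ℝ, W) I ∞ f w) (hx : f w ∈ (chartAt H x).source) :
    DForm.pullbackVec Ω f =ᶠ[𝓝 w] fun w' ↦
      (DForm.inChart I Ω x ((extChartAt I x ∘ f) w')).compContinuousLinearMap
        (fderiv ℝ (extChartAt I x ∘ f) w') := by
  have h2 : ∀ᶠ w' in 𝓝 w, f w' ∈ (chartAt H x).source :=
    hf.continuousAt ((chartAt H x).open_source.mem_nhds hx)
  filter_upwards [eventually_contMDiffAt_one hf, h2] with w' h1 h2
  exact DForm.pullbackVec_eq_inChart Ω x (h1.mdifferentiableAt (by simp)) h2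

theorem DForm.IsSmooth.differentiableAt_pullbackVec {Ω : DForm I X k} (hΩ : DForm.IsSmooth I Ω)
    {f : W → X} {w : W} (hf : ContMDiffAt 𝓘(ℝ, W) I ∞ f w) :
    DifferentiableAt ℝ (DForm.pullbackVec Ω f) w := by
  have hx := mem_chart_source H (f w)
  have hc := contDiffAt_extChartAt_comp hf hx
  refine DifferentiableAt.congr_of_eventuallyEq ?_ (DForm.pullbackVec_eventuallyEq Ω hf hx)
  refine DifferentiableAt.continuousAlternatingMapCompContinuousLinearMap ?_ ?_
  · exact ((hΩ.contDiffAt (mem_extChartAt_target (f w))).differentiableAt (by simp)).comp w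
      (hc.differentiableAt (by simp))
  · exact (hc.fderiv_right (m := 1) (by norm_cast)).differentiableAt (by simp)

/-- Near `w` the pullback is that of the chart expression at `f w` along the chart composed with
`f`, and naturality holds between vector spaces. The chart at `f w` has identity derivative there,
which matches the definition of `DForm.d`. -/
theorem DForm.IsSmooth.extDeriv_pullbackVec_apply {Ω : DForm I X k} (hΩ : DForm.IsSmooth I Ω)
    {f : W → X} {w : W} (hf : ContMDiffAt 𝓘(ℝ, W) I ∞ f w) :
    extDeriv (DForm.pullbackVec Ω f) w = DForm.pullbackVec (DForm.d I Ω) f w := by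
  have hx := mem_chart_source H (f w)
  have hc := contDiffAt_extChartAt_comp hf hx
  rw [(DForm.pullbackVec_eventuallyEq Ω hf hx).extDeriv_eq,
    extDeriv_pullback (f := extChartAt I (f w) ∘ f) (r := ∞) ((hΩ.contDiffAt (mem_extChartAt_target (f w))).differentiableAt
      (by simp)) hc (by simpa using ENat.LEInfty.out)]
  ext v
  rw [DForm.pullbackVec_apply]
  refine Eq.trans ?_ (DForm.d_apply Ω (f w) _).symm
  simp only [ContinuousAlternatingMap.compContinuousLinearMap_apply]
  congr 1
  funext i
  rw [comp_apply, ← mfderiv_eq_fderiv, mfderiv_comp w (mdifferentiableAt_extChartAt hx)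
    (hf.mdifferentiableAt (by simp))]
  exact mfderiv_extChartAt_self_apply (f w) _

/-- `DForm.d` uses a different chart at each point. Naturality along the inverse of one fixed chart
shows that this chart computes it on its whole domain. -/
theorem DForm.IsSmooth.inChart_d {Ω : DForm I X k} (hΩ : DForm.IsSmooth I Ω) (x : X) :
    EqOn (DForm.inChart I (DForm.d I Ω) x) (extDeriv (DForm.inChart I Ω x))
      (extChartAt I x).target := fun _ hy ↦
  (hΩ.extDeriv_pullbackVec_apply (contMDiffAt_extChartAt_symm hy)).symm

/-- The exterior derivative of a smooth form is smooth. -/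
theorem DForm.IsSmooth.d {Ω : DForm I X k} (hΩ : DForm.IsSmooth I Ω) :
    DForm.IsSmooth I (DForm.d I Ω) := by
  intro x
  refine ContDiffOn.congr (fun y hy ↦ ContDiffAt.contDiffWithinAt ?_) (hΩ.inChart_d x)
  exact (ContinuousAlternatingMap.alternatizeUncurryFinCLM ℝ E ℝ).contDiff.contDiffAt.comp y
    ((hΩ.contDiffAt hy).fderiv_right (m := ∞) (by simp))

/-- `d ∘ d = 0`. -/
theorem DForm.IsSmooth.d_d {Ω : DForm I X k} (hΩ : DForm.IsSmooth I Ω) (x : X) :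
    DForm.d I (DForm.d I Ω) x = 0 := by
  refine ContinuousAlternatingMap.ext (M := E) fun v ↦ (DForm.d_apply _ x v).trans ?_
  have h : DForm.inChart I (DForm.d I Ω) x =ᶠ[𝓝 (extChartAt I x x)]
      extDeriv (DForm.inChart I Ω x) :=
    (hΩ.inChart_d x).eventuallyEq_of_mem (extChartAt_target_mem_nhds x)
  rw [h.extDeriv_eq, extDeriv_extDeriv_apply (hΩ.contDiffAt (mem_extChartAt_target x))
    (by simpa using ENat.LEInfty.out)]
  rfl

end Forms

/-! ### Moving points into prescribed fibres of a submersion. -/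

section Submersion

variable {E : Type*} [NormedAddCommGroup E] [NormedSpace ℝ E]
  {H : Type*} [TopologicalSpace H] {I : ModelWithCorners ℝ E H}
  {F : Type*} [NormedAddCommGroup F] [NormedSpace ℝ F]
  {K : Type*} [TopologicalSpace K] {J : ModelWithCorners ℝ F K}
  {G : Type*} [TopologicalSpace G] [ChartedSpace H G]
  {M : Type*} [TopologicalSpace M] [ChartedSpace K M]

theorem hasMFDerivAt_comp_of_eq {E' : Type*} [NormedAddCommGroup E'] [NormedSpace ℝ E']
    {H' : Type*} [TopologicalSpace H'] {I' : ModelWithCorners ℝ E' H'}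
    {N : Type*} [TopologicalSpace N] [ChartedSpace H' N]
    {f : G → M} {g : M → N} {x : G} {y : M} {L : F →L[ℝ] E'} {L' : E →L[ℝ] F}
    (hg : HasMFDerivAt J I' g y L) (hf : HasMFDerivAt I J f x L') (hy : f x = y) :
    HasMFDerivAt I I' (g ∘ f) x (L.comp L') := by
  subst hy
  exact hg.comp x hf

theorem exists_move_to_fiber_of_charts [IsManifold I ∞ G] [IsManifold J ∞ M] [I.Boundaryless]
    {C : Type*} [NormedAddCommGroup C] [NormedSpace ℝ C] {f : G → M} (hfs : ContMDiff I J ∞ f)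
    {g : G} (e : E ≃L[ℝ] F × C) (φ : OpenPartialHomeomorph G H) (ψ : OpenPartialHomeomorph M K)
    (hg : g ∈ φ.source) (hφ : φ ∈ IsManifold.maximalAtlas I ∞ G)
    (hψ : ψ ∈ IsManifold.maximalAtlas J ∞ M) (hsub : φ.source ⊆ f ⁻¹' ψ.source)
    (hw : EqOn (ψ.extend J ∘ f ∘ (φ.extend I).symm) (Prod.fst ∘ e) (φ.extend I).target) :
    ∃ T : G × M → G, ContMDiffAt (I.prod J) I ∞ T (g, f g) ∧ T (g, f g) = g ∧
      (∀ᶠ p in 𝓝 (g, f g), f (T p) = p.2) ∧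
      ∃ L : E × F →L[ℝ] E, HasMFDerivAt (I.prod J) I T (g, f g) L ∧
        ∀ u : TangentSpace I g, L (u, mfderiv I J f g u) = u := by
  -- In charts where `f` is the projection `F × C → F`, the `F`-coordinate is replaced by that of
  -- the prescribed base point and the `C`-coordinate is kept.
  let S : G × M → E := fun p ↦ e.symm (ψ.extend J p.2, (e (φ.extend I p.1)).2)
  let T : G × M → G := fun p ↦ (φ.extend I).symm (S p)
  have hmt : ∀ a ∈ φ.source, φ.extend I a ∈ (φ.extend I).target := fun a ha ↦
    (φ.extend I).map_source (by rwa [φ.extend_source])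
  have hTf : ∀ a ∈ φ.source, S (a, f a) = φ.extend I a := by
    intro a ha
    have h1 := hw (hmt a ha)
    simp only [comp_apply] at h1
    rw [φ.extend_left_inv ha] at h1
    simp only [S]
    rw [h1]
    simp
  have hTid : ∀ a ∈ φ.source, T (a, f a) = a := by
    intro a ha
    simp only [T]
    rw [hTf a ha]
    exact φ.extend_left_inv ha
  have hsrc : φ.source ∈ 𝓝 g := φ.open_source.mem_nhds hg
  have hcod : ψ.source ∈ 𝓝 (f g) := ψ.open_source.mem_nhds (hsub hg)
  have hS : ContMDiffAt (I.prod J) 𝓘(ℝ, E) ∞ S (g, f g) := by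
    have h1 : ContMDiffAt (I.prod J) 𝓘(ℝ, F) ∞ (fun p : G × M ↦ ψ.extend J p.2) (g, f g) :=
      ContMDiffAt.comp (g, f g) (g := ψ.extend J) (ψ.contMDiffAt_extend hψ (hsub hg))
        contMDiffAt_snd
    have h2 : ContMDiffAt (I.prod J) 𝓘(ℝ, E) ∞ (fun p : G × M ↦ φ.extend I p.1) (g, f g) :=
      ContMDiffAt.comp (g, f g) (g := φ.extend I) (φ.contMDiffAt_extend hφ hg) contMDiffAt_fst
    have h3 : ContMDiffAt (I.prod J) 𝓘(ℝ, C) ∞ (fun p : G × M ↦ (e (φ.extend I p.1)).2)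
        (g, f g) :=
      ((contDiff_snd.comp e.contDiff).contMDiff.contMDiffAt).comp (g, f g) h2
    exact e.symm.contDiff.contMDiff.contMDiffAt.comp (g, f g) (h1.prodMk_space h3)
  have htgt : (φ.extend I).target ∈ 𝓝 (S (g, f g)) := by
    rw [hTf g hg]
    exact φ.isOpen_extend_target.mem_nhds (hmt g hg)
  have hT : ContMDiffAt (I.prod J) I ∞ T (g, f g) := by
    refine ContMDiffAt.comp (g, f g) (g := (φ.extend I).symm) ?_ hS
    have := contMDiffOn_extend_symm hφ
    rw [← φ.extend_target'] at this
    exact this.contMDiffAt htgt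
  refine ⟨T, hT, hTid g hg, ?_, mfderiv (I.prod J) I T (g, f g),
    (hT.mdifferentiableAt (by simp)).hasMFDerivAt, ?_⟩
  · have h1 : ∀ᶠ p in 𝓝 (g, f g), S p ∈ (φ.extend I).target := hS.continuousAt htgt
    have h2 : ∀ᶠ p in 𝓝 (g, f g), p.2 ∈ ψ.source := continuousAt_snd hcod
    filter_upwards [h1, h2] with p h1 h2
    have h3 : ψ.extend J (f (T p)) = ψ.extend J p.2 := by
      refine (hw h1).trans ?_
      simp [S]
    have h4 : T p ∈ φ.source := by
      rw [← φ.extend_source (I := I)]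
      exact (φ.extend I).map_target h1
    refine (ψ.extend J).injOn ?_ ?_ h3
    · rw [ψ.extend_source]
      exact hsub h4
    · rwa [ψ.extend_source]
  · intro u
    have hfd := (hfs.mdifferentiableAt (x := g) (by simp)).hasMFDerivAt
    have h1 := (hT.mdifferentiableAt (by simp)).hasMFDerivAt.comp g
      ((hasMFDerivAt_id (I := I) g).prodMk hfd)
    -- A point already in its fibre is not moved; differentiating `T (a, f a) = a` gives the claim
    -- about `L`.
    have h2 : T ∘ (fun a ↦ (id a, f a)) =ᶠ[𝓝 g] id := by
      filter_upwards [hsrc] with a ha using hTid a ha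
    have h3 := hasMFDerivAt_unique ((hasMFDerivAt_id (I := I) g).congr_of_eventuallyEq h2) h1
    exact (congrArg (fun L : E →L[ℝ] E ↦ L u) h3).symm

/-- For a submersion `f`, the points near `g` can be moved smoothly to a prescribed fibre. -/
theorem exists_move_to_fiber [IsManifold I ∞ G] [IsManifold J ∞ M] [I.Boundaryless]
    {f : G → M} (hf : Manifold.IsSubmersion I J ∞ f) {g : G} {m : M}
    (hm : f g = m) :
    ∃ T : G × M → G, ContMDiffAt (I.prod J) I ∞ T (g, m) ∧ T (g, m) = g ∧
      (∀ᶠ p in 𝓝 (g, m), f (T p) = p.2) ∧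
      ∃ L : E × F →L[ℝ] E, HasMFDerivAt (I.prod J) I T (g, m) L ∧
        ∀ u : TangentSpace I g, L (u, mfderiv I J f g u) = u := by
  subst hm
  have hfs : ContMDiff I J ∞ f := hf.contMDiff
  obtain ⟨C, i1, i2, hC⟩ := hf
  exact exists_move_to_fiber_of_charts hfs (hC g).equiv (hC g).domChart (hC g).codChart
    (hC g).mem_domChart_source (hC g).domChart_mem_maximalAtlas (hC g).codChart_mem_maximalAtlas
    (hC g).source_subset_preimage_source (hC g).writtenInCharts

end Submersion

/-! ### Local parametrization of the composable pairs. -/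

namespace LieGroupoid

variable {E : Type*} [NormedAddCommGroup E] [NormedSpace ℝ E]
  {H : Type*} [TopologicalSpace H] {I : ModelWithCorners ℝ E H}
  {F : Type*} [NormedAddCommGroup F] [NormedSpace ℝ F]
  {K : Type*} [TopologicalSpace K] {J : ModelWithCorners ℝ F K}
  {G : Type*} [TopologicalSpace G] [ChartedSpace H G]
  {M : Type*} [TopologicalSpace M] [ChartedSpace K M]
  (𝒢 : LieGroupoid I J G M)

theorem tangentComposable_iff {g h : G} (u : TangentSpace I g) (v : TangentSpace I h) :
    𝒢.TangentComposable u v ↔ 𝒢.src g = 𝒢.tgt h ∧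
      (mfderiv I J 𝒢.src g u : F) = mfderiv I J 𝒢.tgt h v := by
  constructor
  · intro huv
    exact ⟨congrArg Bundle.TotalSpace.proj huv,
      congrArg (fun z : TangentBundle J M ↦ (z.2 : F)) huv⟩
  · rintro ⟨h1, h2⟩
    have : ∀ (x y : M) (a : TangentSpace J x) (b : TangentSpace J y), x = y → (a : F) = b →
        (⟨x, a⟩ : TangentBundle J M) = ⟨y, b⟩ := by
      rintro x y a b rfl hab
      exact congrArg _ hab
    exact this _ _ _ _ h1 h2

variable [IsManifold I ∞ G] [IsManifold J ∞ M] [I.Boundaryless]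

/-- A smooth parametrization of the composable pairs near a given one. -/
theorem exists_param_composable {g h : G} (hgh : 𝒢.src g = 𝒢.tgt h) :
    ∃ (a b : E × E → G) (w₀ : E × E), a w₀ = g ∧ b w₀ = h ∧
      ContMDiffAt 𝓘(ℝ, E × E) I ∞ a w₀ ∧ ContMDiffAt 𝓘(ℝ, E × E) I ∞ b w₀ ∧
      (∀ᶠ w in 𝓝 w₀, 𝒢.src (a w) = 𝒢.tgt (b w)) ∧
      ∀ (u : TangentSpace I g) (v : TangentSpace I h), 𝒢.TangentComposable u v →
        (mfderiv 𝓘(ℝ, E × E) I a w₀ (u, v) : E) = u ∧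
        (mfderiv 𝓘(ℝ, E × E) I b w₀ (u, v) : E) = v := by
  obtain ⟨T, hT, hTg, hTf, L, hL, hLu⟩ := exists_move_to_fiber 𝒢.submersion_src hgh
  let w₀ : E × E := (extChartAt I g g, extChartAt I h h)
  let a₁ : E × E → G := fun w ↦ (extChartAt I g).symm w.1
  let b : E × E → G := fun w ↦ (extChartAt I h).symm w.2
  have ha₁w : a₁ w₀ = g := extChartAt_to_inv g
  have hbw : b w₀ = h := extChartAt_to_inv h
  have ha₁ : ContMDiffAt 𝓘(ℝ, E × E) I ∞ a₁ w₀ :=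
    ContMDiffAt.comp w₀ (contMDiffAt_extChartAt_symm (mem_extChartAt_target g))
      contDiff_fst.contMDiff.contMDiffAt
  have hb : ContMDiffAt 𝓘(ℝ, E × E) I ∞ b w₀ :=
    ContMDiffAt.comp w₀ (contMDiffAt_extChartAt_symm (mem_extChartAt_target h))
      contDiff_snd.contMDiff.contMDiffAt
  have hda₁ : ∀ w : E × E, (mfderiv 𝓘(ℝ, E × E) I a₁ w₀ w : E) = w.1 := by
    intro w
    have h1 := mfderiv_comp_apply (f := (Prod.fst : E × E → E)) (g := (extChartAt I g).symm)
      (I := 𝓘(ℝ, E × E)) (I' := 𝓘(ℝ, E)) (I'' := I) w₀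
      ((contMDiffAt_extChartAt_symm (mem_extChartAt_target g)).mdifferentiableAt (by simp))
      differentiableAt_fst.mdifferentiableAt w
    refine h1.trans ?_
    rw [mfderiv_eq_fderiv, fderiv_fst]
    exact mfderiv_extChartAt_symm_self_apply g w.1
  have hdb : ∀ w : E × E, (mfderiv 𝓘(ℝ, E × E) I b w₀ w : E) = w.2 := by
    intro w
    have h1 := mfderiv_comp_apply (f := (Prod.snd : E × E → E)) (g := (extChartAt I h).symm)
      (I := 𝓘(ℝ, E × E)) (I' := 𝓘(ℝ, E)) (I'' := I) w₀
      ((contMDiffAt_extChartAt_symm (mem_extChartAt_target h)).mdifferentiableAt (by simp))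
      differentiableAt_snd.mdifferentiableAt w
    refine h1.trans ?_
    rw [mfderiv_eq_fderiv, fderiv_snd]
    exact mfderiv_extChartAt_symm_self_apply h w.2
  have htb : ContMDiffAt 𝓘(ℝ, E × E) J ∞ (𝒢.tgt ∘ b) w₀ :=
    𝒢.submersion_tgt.contMDiff.contMDiffAt.comp w₀ hb
  -- Both arrows vary freely in charts; `T` then moves the first into the source fibre over the
  -- target of the second.
  let p : E × E → G × M := fun w ↦ (a₁ w, 𝒢.tgt (b w))
  have hp : ContMDiffAt 𝓘(ℝ, E × E) (I.prod J) ∞ p w₀ := ha₁.prodMk htb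
  have hpw : p w₀ = (g, 𝒢.tgt h) := Prod.ext ha₁w (congrArg 𝒢.tgt hbw)
  refine ⟨T ∘ p, b, w₀, (congrArg T hpw).trans hTg, hbw, hT.comp_of_eq hp hpw, hb, ?_, ?_⟩
  · have := hp.continuousAt.tendsto
    rw [hpw] at this
    exact this.eventually hTf
  · intro u v huv
    refine ⟨?_, hdb (u, v)⟩
    have h2 : HasMFDerivAt 𝓘(ℝ, E × E) (I.prod J) p w₀
        ((mfderiv 𝓘(ℝ, E × E) I a₁ w₀ : E × E →L[ℝ] E).prod
          (mfderiv 𝓘(ℝ, E × E) J (𝒢.tgt ∘ b) w₀ : E × E →L[ℝ] F)) :=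
      (ha₁.mdifferentiableAt (by simp)).hasMFDerivAt.prodMk
        (htb.mdifferentiableAt (by simp)).hasMFDerivAt
    have h3 := (hasMFDerivAt_comp_of_eq hL h2 hpw).mfderiv
    have h4 : (mfderiv 𝓘(ℝ, E × E) I (T ∘ p) w₀ (u, v) : E) =
        L (mfderiv 𝓘(ℝ, E × E) I a₁ w₀ (u, v), mfderiv 𝓘(ℝ, E × E) J (𝒢.tgt ∘ b) w₀ (u, v)) :=
      congrArg (fun L : E × E →L[ℝ] E ↦ L (u, v)) h3
    refine h4.trans ?_
    -- For a composable `(u, v)` the prescribed base point moves with velocity `dβ(v) = dα(u)`, so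
    -- `T` leaves `u` unchanged to first order.
    have h5 : (mfderiv 𝓘(ℝ, E × E) J (𝒢.tgt ∘ b) w₀ (u, v) : F) = mfderiv I J 𝒢.src g u := by
      rw [((𝒢.tangentComposable_iff u v).1 huv).2]
      have hbd : HasMFDerivAt 𝓘(ℝ, E × E) I b w₀ (mfderiv 𝓘(ℝ, E × E) I b w₀ : E × E →L[ℝ] E) :=
        (hb.mdifferentiableAt (by simp)).hasMFDerivAt
      let L₁ : E →L[ℝ] F := mfderiv I J 𝒢.tgt h
      have hL₁ : HasMFDerivAt I J 𝒢.tgt h L₁ :=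
        (𝒢.submersion_tgt.contMDiff.mdifferentiableAt (x := h) (by simp)).hasMFDerivAt
      have h6 := (hasMFDerivAt_comp_of_eq hL₁ hbd hbw).mfderiv
      refine (congrArg (fun L : E × E →L[ℝ] F ↦ L (u, v)) h6).trans ?_
      exact congrArg L₁ (hdb (u, v))
    rw [h5]
    refine Eq.trans ?_ (hLu u)
    exact congrArg (fun z : E ↦ L (z, mfderiv I J 𝒢.src g u)) (hda₁ (u, v))

end LieGroupoid

/-! ### The tangent product and differentials of multiplicative forms. -/

namespace LieGroupoid

variable {E : Type*} [NormedAddCommGroup E] [NormedSpace ℝ E]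
  {H : Type*} [TopologicalSpace H] {I : ModelWithCorners ℝ E H}
  {F : Type*} [NormedAddCommGroup F] [NormedSpace ℝ F]
  {K : Type*} [TopologicalSpace K] {J : ModelWithCorners ℝ F K}
  {G : Type*} [TopologicalSpace G] [ChartedSpace H G]
  {M : Type*} [TopologicalSpace M] [ChartedSpace K M]
  {W : Type*} [NormedAddCommGroup W] [NormedSpace ℝ W]
  (𝒢 : LieGroupoid I J G M)

/-- The pair `(a, b)` stays among composable pairs near `w`, so any derivative `L` of the product
within them yields an unrestricted derivative of the composite. -/
theorem hasMFDerivAt_mul_param {a b : W → G} {w : W} {L : E × E →L[ℝ] E}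
    (hL : HasMFDerivWithinAt (I.prod I) I (fun q : G × G ↦ 𝒢.mul q.1 q.2) 𝒢.composable
      (a w, b w) L)
    (ha : MDifferentiableAt 𝓘(ℝ, W) I a w) (hb : MDifferentiableAt 𝓘(ℝ, W) I b w)
    (hab : ∀ᶠ w' in 𝓝 w, 𝒢.src (a w') = 𝒢.tgt (b w')) :
    HasMFDerivAt 𝓘(ℝ, W) I (fun w' ↦ 𝒢.mul (a w') (b w')) w
      (L.comp ((mfderiv 𝓘(ℝ, W) I a w : W →L[ℝ] E).prod (mfderiv 𝓘(ℝ, W) I b w : W →L[ℝ] E))) :=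
  (HasMFDerivWithinAt.comp w (f := fun w' ↦ (a w', b w')) hL
    (ha.hasMFDerivAt.prodMk hb.hasMFDerivAt).hasMFDerivWithinAt
    (s := {w' | 𝒢.src (a w') = 𝒢.tgt (b w')}) (fun _ hw' ↦ hw')).hasMFDerivAt hab

theorem tangentComposable_param {a b : W → G} {w : W}
    (ha : MDifferentiableAt 𝓘(ℝ, W) I a w) (hb : MDifferentiableAt 𝓘(ℝ, W) I b w)
    (hab : ∀ᶠ w' in 𝓝 w, 𝒢.src (a w') = 𝒢.tgt (b w')) (z : W) :
    𝒢.TangentComposable (mfderiv 𝓘(ℝ, W) I a w z) (mfderiv 𝓘(ℝ, W) I b w z) := by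
  rw [tangentComposable_iff]
  refine ⟨hab.self_of_nhds, ?_⟩
  have h : 𝒢.src ∘ a =ᶠ[𝓝 w] 𝒢.tgt ∘ b := hab
  have hs := mfderiv_comp_apply w (𝒢.submersion_src.contMDiff.mdifferentiableAt (by simp)) ha z
  have ht := mfderiv_comp_apply w (𝒢.submersion_tgt.contMDiff.mdifferentiableAt (by simp)) hb z
  refine hs.symm.trans (Eq.trans ?_ ht)
  exact congrArg (fun L : W →L[ℝ] F ↦ L z) h.mfderiv_eq

theorem mdifferentiableWithinAt_mul {g h : G} (hgh : 𝒢.src g = 𝒢.tgt h) :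
    MDifferentiableWithinAt (I.prod I) I (fun q : G × G ↦ 𝒢.mul q.1 q.2) 𝒢.composable (g, h) :=
  (𝒢.smooth_mul (g, h) hgh).mdifferentiableWithinAt (by simp)

theorem mfderiv_mul_param {a b : W → G} {w : W}
    (ha : MDifferentiableAt 𝓘(ℝ, W) I a w) (hb : MDifferentiableAt 𝓘(ℝ, W) I b w)
    (hab : ∀ᶠ w' in 𝓝 w, 𝒢.src (a w') = 𝒢.tgt (b w')) (z : W) :
    (mfderiv 𝓘(ℝ, W) I (fun w' ↦ 𝒢.mul (a w') (b w')) w z : E) =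
      𝒢.tangentMul (mfderiv 𝓘(ℝ, W) I a w z) (mfderiv 𝓘(ℝ, W) I b w z) :=
  congrArg (fun L : W →L[ℝ] E ↦ L z) (𝒢.hasMFDerivAt_mul_param
    (𝒢.mdifferentiableWithinAt_mul hab.self_of_nhds).hasMFDerivWithinAt ha hb hab).mfderiv

variable [IsManifold I ∞ G] [IsManifold J ∞ M] [I.Boundaryless]

/-- All derivatives of the product within the composable pairs have the same value on vectors
tangent to the composable pairs. -/
theorem tangentMul_eq {g h : G} (hgh : 𝒢.src g = 𝒢.tgt h) {L : E × E →L[ℝ] E}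
    (hL : HasMFDerivWithinAt (I.prod I) I (fun q : G × G ↦ 𝒢.mul q.1 q.2) 𝒢.composable (g, h) L)
    {u : TangentSpace I g} {v : TangentSpace I h} (huv : 𝒢.TangentComposable u v) :
    (𝒢.tangentMul u v : E) = L (u, v) := by
  obtain ⟨a, b, w₀, rfl, rfl, ha, hb, hab, hd⟩ := 𝒢.exists_param_composable hgh
  have ha' := ha.mdifferentiableAt (by simp)
  have hb' := hb.mdifferentiableAt (by simp)
  obtain ⟨hu, hv⟩ := hd u v huv
  have h1 := 𝒢.hasMFDerivAt_mul_param
    (𝒢.mdifferentiableWithinAt_mul hab.self_of_nhds).hasMFDerivWithinAt ha' hb' hab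
  have h2 := 𝒢.hasMFDerivAt_mul_param hL ha' hb' hab
  -- Both candidates give a derivative of one map on a neighbourhood in `E × E`, where derivatives
  -- are unique.
  have h3 := congrArg (fun L : E × E →L[ℝ] E ↦ L (u, v)) (hasMFDerivAt_unique h1 h2)
  let L₁ : E × E →L[ℝ] E := mfderivWithin (I.prod I) I (fun q : G × G ↦ 𝒢.mul q.1 q.2)
    𝒢.composable (a w₀, b w₀)
  let A : E × E →L[ℝ] E := mfderiv 𝓘(ℝ, E × E) I a w₀
  let B : E × E →L[ℝ] E := mfderiv 𝓘(ℝ, E × E) I b w₀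
  change L₁ (A (u, v), B (u, v)) = L (A (u, v), B (u, v)) at h3
  change A (u, v) = u at hu
  change B (u, v) = v at hv
  rw [hu, hv] at h3
  exact h3

/-- A 1-form is multiplicative. -/
def IsMultiplicativeOneForm (Θ : DForm I G 1) : Prop :=
  ∀ g h, 𝒢.src g = 𝒢.tgt h → ∀ (u : TangentSpace I g) (v : TangentSpace I h),
    𝒢.TangentComposable u v → Θ (𝒢.mul g h) ![𝒢.tangentMul u v] = Θ g ![u] + Θ h ![v]

variable {𝒢} in
/-- The differential of a multiplicative 1-form is multiplicative. -/
theorem IsMultiplicativeOneForm.d {Θ : DForm I G 1} (hm : 𝒢.IsMultiplicativeOneForm Θ)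
    (hΘ : DForm.IsSmooth I Θ) : 𝒢.IsMultiplicativeForm (DForm.d I Θ) := by
  intro g h hgh u u' v v' huv huv'
  obtain ⟨a, b, w₀, rfl, rfl, ha, hb, hab, hd⟩ := 𝒢.exists_param_composable hgh
  have hc : ContMDiffAt 𝓘(ℝ, E × E) I ∞ (fun w ↦ 𝒢.mul (a w) (b w)) w₀ := by
    refine ContMDiffWithinAt.contMDiffAt (s := {w | 𝒢.src (a w) = 𝒢.tgt (b w)}) ?_ hab
    exact ContMDiffWithinAt.comp w₀ (f := fun w ↦ (a w, b w)) (𝒢.smooth_mul (a w₀, b w₀) hgh)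
      (ha.prodMk hb).contMDiffWithinAt fun _ hw ↦ hw
  -- On the parameter space multiplicativity is an equality of forms on a neighbourhood, to which
  -- `extDeriv` applies.
  have hev : DForm.pullbackVec Θ (fun w ↦ 𝒢.mul (a w) (b w)) =ᶠ[𝓝 w₀]
      fun w ↦ DForm.pullbackVec Θ a w + DForm.pullbackVec Θ b w := by
    filter_upwards [eventually_contMDiffAt_one ha, eventually_contMDiffAt_one hb,
      hab.eventually_nhds] with w ha hb hab
    have ha' := ha.mdifferentiableAt (by simp)
    have hb' := hb.mdifferentiableAt (by simp)
    ext z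
    have hz : z = ![z 0] := List.ofFn_inj.mp rfl
    have h1 := hm (a w) (b w) hab.self_of_nhds _ _ (𝒢.tangentComposable_param ha' hb' hab (z 0))
    rw [hz]
    refine (DForm.pullbackVec_apply_one Θ _ w (z 0)).trans ?_
    rw [ContinuousAlternatingMap.add_apply, DForm.pullbackVec_apply_one,
      DForm.pullbackVec_apply_one]
    refine Eq.trans ?_ h1
    exact congrArg (fun y : E ↦ Θ (𝒢.mul (a w) (b w)) ![y]) (𝒢.mfderiv_mul_param ha' hb' hab (z 0))
  have hd1 := hev.extDeriv_eq
  rw [extDeriv_fun_add (hΘ.differentiableAt_pullbackVec ha) (hΘ.differentiableAt_pullbackVec hb),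
    hΘ.extDeriv_pullbackVec_apply ha, hΘ.extDeriv_pullbackVec_apply hb,
    hΘ.extDeriv_pullbackVec_apply hc] at hd1
  have ha' := ha.mdifferentiableAt (by simp)
  have hb' := hb.mdifferentiableAt (by simp)
  have hmul : ∀ (u : TangentSpace I (a w₀)) (v : TangentSpace I (b w₀)),
      𝒢.TangentComposable u v →
      (mfderiv 𝓘(ℝ, E × E) I (fun w ↦ 𝒢.mul (a w) (b w)) w₀ (u, v) : E) = 𝒢.tangentMul u v := by
    intro u v huv
    refine (𝒢.mfderiv_mul_param ha' hb' hab (u, v)).trans ?_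
    obtain ⟨hu, hv⟩ := hd u v huv
    exact congrArg₂ (fun y z : E ↦ (𝒢.tangentMul (g := a w₀) (h := b w₀) y z : E)) hu hv
  have h2 := congrArg (fun α : (E × E) [⋀^Fin 2]→L[ℝ] ℝ ↦ α ![(u, v), (u', v')]) hd1
  simp only [ContinuousAlternatingMap.add_apply] at h2
  have e1 : DForm.pullbackVec (DForm.d I Θ) (fun w ↦ 𝒢.mul (a w) (b w)) w₀ ![(u, v), (u', v')] =
      DForm.d I Θ (𝒢.mul (a w₀) (b w₀)) ![𝒢.tangentMul u v, 𝒢.tangentMul u' v'] :=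
    (DForm.pullbackVec_apply_two _ _ w₀ _ _).trans <|
      congrArg₂ (fun y z : E ↦ DForm.d I Θ (𝒢.mul (a w₀) (b w₀)) ![y, z]) (hmul u v huv)
        (hmul u' v' huv')
  have e2 : DForm.pullbackVec (DForm.d I Θ) a w₀ ![(u, v), (u', v')] =
      DForm.d I Θ (a w₀) ![u, u'] :=
    (DForm.pullbackVec_apply_two _ _ w₀ _ _).trans <|
      congrArg₂ (fun y z : E ↦ DForm.d I Θ (a w₀) ![y, z]) (hd u v huv).1 (hd u' v' huv').1
  have e3 : DForm.pullbackVec (DForm.d I Θ) b w₀ ![(u, v), (u', v')] =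
      DForm.d I Θ (b w₀) ![v, v'] :=
    (DForm.pullbackVec_apply_two _ _ w₀ _ _).trans <|
      congrArg₂ (fun y z : E ↦ DForm.d I Θ (b w₀) ![y, z]) (hd u v huv).2 (hd u' v' huv').2
  exact e1.symm.trans (h2.trans (congrArg₂ (· + ·) e2 e3))

end LieGroupoid

/-! ### Exterior derivatives of 1-forms and 2-forms, written out. -/

section Alternatize

variable {E : Type*} [NormedAddCommGroup E] [NormedSpace ℝ E]

theorem alternatizeUncurryFin_two (L : E →L[ℝ] E [⋀^Fin 1]→L[ℝ] ℝ) (x y : E) :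
    ContinuousAlternatingMap.alternatizeUncurryFin L ![x, y] = L x ![y] - L y ![x] := by
  rw [ContinuousAlternatingMap.alternatizeUncurryFin_apply, Fin.sum_univ_two]
  have h0 : (0 : Fin 2).removeNth ![x, y] = ![y] := by
    funext i; fin_cases i; rfl
  have h1 : (1 : Fin 2).removeNth ![x, y] = ![x] := by
    funext i; fin_cases i; rfl
  rw [h0, h1]
  simp [sub_eq_add_neg]

theorem alternatizeUncurryFin_three (L : E →L[ℝ] E [⋀^Fin 2]→L[ℝ] ℝ) (x y z : E) :
    ContinuousAlternatingMap.alternatizeUncurryFin L ![x, y, z] =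
      L x ![y, z] - L y ![x, z] + L z ![x, y] := by
  rw [ContinuousAlternatingMap.alternatizeUncurryFin_apply, Fin.sum_univ_three]
  have h0 : (0 : Fin 3).removeNth ![x, y, z] = ![y, z] := by
    funext i; fin_cases i <;> rfl
  have h1 : (1 : Fin 3).removeNth ![x, y, z] = ![x, z] := by
    funext i; fin_cases i <;> rfl
  have h2 : (2 : Fin 3).removeNth ![x, y, z] = ![x, y] := by
    funext i; fin_cases i <;> rfl
  rw [h0, h1, h2]
  simp [sub_eq_add_neg]

end Alternatize

/-! ### Forms on `Σ × ℝ` in product charts, and the Lie derivative along `∂/∂s`. -/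

section Product

variable {E : Type*} [NormedAddCommGroup E] [NormedSpace ℝ E]
  {H : Type*} [TopologicalSpace H] {I : ModelWithCorners ℝ E H}
  {G : Type*} [TopologicalSpace G] [ChartedSpace H G] {k : ℕ}

theorem extChartAt_prod_real_apply (p q : G × ℝ) :
    extChartAt (I.prod 𝓘(ℝ, ℝ)) p q = (extChartAt I p.1 q.1, q.2) := by
  rw [extChartAt_prod, extChartAt_model_space_eq_id]; simp

theorem extChartAt_prod_real_symm (p : G × ℝ) :
    ((extChartAt (I.prod 𝓘(ℝ, ℝ)) p).symm : E × ℝ → G × ℝ) =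
      fun w ↦ ((extChartAt I p.1).symm w.1, w.2) := by
  funext w
  rw [extChartAt_prod, extChartAt_model_space_eq_id]; simp

theorem extChartAt_prod_real_target (p : G × ℝ) :
    (extChartAt (I.prod 𝓘(ℝ, ℝ)) p).target = (extChartAt I p.1).target ×ˢ univ := by
  rw [extChartAt_prod, extChartAt_model_space_eq_id]; simp

theorem expForm_apply (θ : DForm I G 1) (p : G × ℝ) (u : E) (a : ℝ) :
    expForm I θ p ![((u, a) : E × ℝ)] = Real.exp p.2 * θ p.1 ![u] := by
  change Real.exp p.2 * θ p.1
    (fun i ↦ mfderiv (I.prod 𝓘(ℝ, ℝ)) I Prod.fst p (![((u, a) : E × ℝ)] i)) = _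
  rw [mfderiv_fst]
  congr 2
  funext i
  fin_cases i
  rfl

theorem mfderiv_prod_zero (g : G) (u : E) :
    (mfderiv I (I.prod 𝓘(ℝ, ℝ)) (fun g : G ↦ (g, (0 : ℝ))) g u : E × ℝ) = (u, 0) := by
  rw [mfderiv_prod_left]; rfl

theorem contactization_apply (Ω : DForm (I.prod 𝓘(ℝ, ℝ)) (G × ℝ) 2) (g : G) (u : E) :
    contactization I Ω g ![u] = Ω (g, 0) ![((0, 1) : E × ℝ), (u, 0)] := by
  change Ω (g, 0) (Fin.cons ((0, 1) : E × ℝ)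
    (fun i ↦ mfderiv I (I.prod 𝓘(ℝ, ℝ)) (fun g : G ↦ (g, (0 : ℝ))) g (![u] i))) = _
  congr 1
  funext i
  refine Fin.cases ?_ (fun i ↦ ?_) i
  · rfl
  · fin_cases i
    exact mfderiv_prod_zero g u

variable [IsManifold I ∞ G] [I.Boundaryless]

theorem mfderiv_extChartAt_prod_symm {p : G × ℝ} {y : E} (hy : y ∈ (extChartAt I p.1).target)
    (t : ℝ) (v : E × ℝ) :
    (mfderiv 𝓘(ℝ, E × ℝ) (I.prod 𝓘(ℝ, ℝ)) (extChartAt (I.prod 𝓘(ℝ, ℝ)) p).symm (y, t) v : E × ℝ) =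
      (mfderiv 𝓘(ℝ, E) I (extChartAt I p.1).symm y v.1, v.2) := by
  rw [extChartAt_prod_real_symm]
  let A : E →L[ℝ] E := mfderiv 𝓘(ℝ, E) I (extChartAt I p.1).symm y
  have hA : HasMFDerivAt 𝓘(ℝ, E) I (extChartAt I p.1).symm y A :=
    ((contMDiffAt_extChartAt_symm hy).mdifferentiableAt (by simp)).hasMFDerivAt
  have h1 : HasMFDerivAt 𝓘(ℝ, E × ℝ) I (fun w : E × ℝ ↦ (extChartAt I p.1).symm w.1) (y, t)
      (A.comp (ContinuousLinearMap.fst ℝ E ℝ)) :=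
    HasMFDerivAt.comp (y, t) (f := (Prod.fst : E × ℝ → E)) hA hasFDerivAt_fst.hasMFDerivAt
  have h2 : HasMFDerivAt 𝓘(ℝ, E × ℝ) 𝓘(ℝ, ℝ) (fun w : E × ℝ ↦ w.2) (y, t)
      (ContinuousLinearMap.snd ℝ E ℝ) := hasFDerivAt_snd.hasMFDerivAt
  have h3 := (h1.prodMk h2).mfderiv
  exact congrArg (fun L : E × ℝ →L[ℝ] E × ℝ ↦ L v) h3

theorem inChart_expForm (θ : DForm I G 1) (p : G × ℝ) {w : E × ℝ}
    (hw : w ∈ (extChartAt (I.prod 𝓘(ℝ, ℝ)) p).target) :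
    DForm.inChart (I.prod 𝓘(ℝ, ℝ)) (expForm I θ) p w =
      Real.exp w.2 • ContinuousAlternatingMap.compContinuousLinearMapCLM
        (ContinuousLinearMap.fst ℝ E ℝ) (DForm.inChart I θ p.1 w.1) := by
  rw [extChartAt_prod_real_target] at hw
  ext z
  have hz : z = ![z 0] := List.ofFn_inj.mp rfl
  rw [hz]
  refine (DForm.pullbackVec_apply_one (expForm I θ) _ w (z 0)).trans ?_
  have h1 := mfderiv_extChartAt_prod_symm hw.1 w.2 (z 0)
  refine (congrArg (fun x : E × ℝ ↦ expForm I θ ((extChartAt (I.prod 𝓘(ℝ, ℝ)) p).symm w) ![x])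
    h1).trans ?_
  refine (expForm_apply θ _ _ _).trans ?_
  rw [extChartAt_prod_real_symm]
  change _ * _ = Real.exp w.2 * DForm.pullbackVec θ _ _ _
  congr 1
  refine (DForm.pullbackVec_apply_one θ (extChartAt I p.1).symm w.1 (z 0).1).symm.trans ?_
  congr 1
  funext i
  fin_cases i
  rfl

theorem expForm_isSmooth {θ : DForm I G 1} (hθ : DForm.IsSmooth I θ) :
    DForm.IsSmooth (I.prod 𝓘(ℝ, ℝ)) (expForm I θ) := by
  intro p
  refine ContDiffOn.congr ?_ fun w hw ↦ inChart_expForm θ p hw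
  rw [extChartAt_prod_real_target]
  refine (Real.contDiff_exp.comp contDiff_snd).contDiffOn.smul ?_
  exact (ContinuousLinearMap.contDiff _).comp_contDiffOn
    ((hθ p.1).comp contDiff_fst.contDiffOn fun w hw ↦ hw.1)

/-- The formula `d(eˢ θ) = eˢ (ds ∧ θ + dθ)`. -/
theorem symplectization_apply {θ : DForm I G 1} (hθ : DForm.IsSmooth I θ) (g : G) (s : ℝ)
    (u v : E) (a b : ℝ) :
    symplectization I θ (g, s) ![((u, a) : E × ℝ), (v, b)] =
      Real.exp s * (a * θ g ![v] - b * θ g ![u] + DForm.d I θ g ![u, v]) := by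
  let y := extChartAt I g g
  refine (DForm.d_apply (expForm I θ) (g, s) _).trans ?_
  let Λ : (E [⋀^Fin 1]→L[ℝ] ℝ) →L[ℝ] (E × ℝ) [⋀^Fin 1]→L[ℝ] ℝ :=
    ContinuousAlternatingMap.compContinuousLinearMapCLM (ContinuousLinearMap.fst ℝ E ℝ)
  have hev : DForm.inChart (I.prod 𝓘(ℝ, ℝ)) (expForm I θ) (g, s) =ᶠ[𝓝 (y, s)]
      fun w : E × ℝ ↦ Real.exp w.2 • Λ (DForm.inChart I θ g w.1) := by
    have := extChartAt_target_mem_nhds (I := I.prod 𝓘(ℝ, ℝ)) ((g, s) : G × ℝ)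
    rw [extChartAt_prod_real_apply] at this
    filter_upwards [this] with w hw using inChart_expForm θ (g, s) hw
  have hη : HasFDerivAt (DForm.inChart I θ g) (fderiv ℝ (DForm.inChart I θ g) y) y :=
    ((hθ.contDiffAt (mem_extChartAt_target g)).differentiableAt (by simp)).hasFDerivAt
  have hexp : HasFDerivAt (fun w : E × ℝ ↦ Real.exp w.2)
      (Real.exp s • ContinuousLinearMap.snd ℝ E ℝ) (y, s) := by
    have h : HasFDerivAt (fun w : E × ℝ ↦ w.2) (ContinuousLinearMap.snd ℝ E ℝ) (y, s) :=
      hasFDerivAt_snd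
    exact h.exp
  have hcomp : HasFDerivAt (fun w : E × ℝ ↦ Λ (DForm.inChart I θ g w.1))
      (Λ.comp ((fderiv ℝ (DForm.inChart I θ g) y).comp (ContinuousLinearMap.fst ℝ E ℝ))) (y, s) :=
    Λ.hasFDerivAt.comp (y, s) (f := fun w : E × ℝ ↦ DForm.inChart I θ g w.1)
      (HasFDerivAt.comp (y, s) (f := (Prod.fst : E × ℝ → E)) hη hasFDerivAt_fst)
  -- Product rule: differentiating `eˢ` produces `ds ∧ θ`, differentiating the coefficients of `θ`
  -- produces `dθ`.
  have hfd : extDeriv (DForm.inChart (I.prod 𝓘(ℝ, ℝ)) (expForm I θ) (g, s)) (y, s) =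
      ContinuousAlternatingMap.alternatizeUncurryFin _ :=
    hev.extDeriv_eq.trans
      (congrArg ContinuousAlternatingMap.alternatizeUncurryFin (hexp.smul hcomp).fderiv)
  rw [extChartAt_prod_real_apply]
  refine (congrArg (fun α : (E × ℝ) [⋀^Fin 2]→L[ℝ] ℝ ↦ α ![(u, a), (v, b)]) hfd).trans ?_
  refine (alternatizeUncurryFin_two _ _ _).trans ?_
  have h1 : DForm.d I θ g ![u, v] = fderiv ℝ (DForm.inChart I θ g) y u ![v] -
      fderiv ℝ (DForm.inChart I θ g) y v ![u] := by
    refine (DForm.d_apply θ g ![u, v]).trans ?_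
    rw [extDeriv, alternatizeUncurryFin_two]
  have h2 : ∀ (α : E [⋀^Fin 1]→L[ℝ] ℝ) (x : E) (c : ℝ), Λ α ![(x, c)] = α ![x] := by
    intro α x c
    change α _ = α _
    congr 1
    funext i
    fin_cases i
    rfl
  have h3 : ∀ x : E, DForm.inChart I θ g y ![x] = θ g ![x] :=
    fun x ↦ DForm.inChart_self_apply θ g ![x]
  rw [h1]
  simp only [add_apply, smul_apply,
    ContinuousLinearMap.smulRight_apply, ContinuousLinearMap.comp_apply,
    ContinuousAlternatingMap.add_apply, ContinuousAlternatingMap.smul_apply, smul_eq_mul,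
    ContinuousLinearMap.coe_fst', ContinuousLinearMap.coe_snd']
  change Real.exp s * Λ _ ![(v, b)] + (Real.exp s * a) * Λ _ ![(v, b)] -
    (Real.exp s * Λ _ ![(u, a)] + (Real.exp s * b) * Λ _ ![(u, a)]) = _
  simp only [h2]
  rw [h3, h3]
  ring

/-- The charts of `G × ℝ` are charts of `G` times the identity, so the field is constant in them.
Its derivative then drops out of the Lie derivative. -/
theorem VField.inChart_partialS (p : G × ℝ) {w : E × ℝ}
    (hw : w ∈ (extChartAt (I.prod 𝓘(ℝ, ℝ)) p).target) :
    VField.inChart (I.prod 𝓘(ℝ, ℝ)) (partialS I G) p w = (0, 1) := by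
  have hw' := hw
  rw [extChartAt_prod_real_target] at hw'
  have h1 := mfderiv_extChartAt_prod_symm hw'.1 w.2 ((0, 1) : E × ℝ)
  have h2 := mfderiv_mfderiv_symm_extChartAt hw ((0, 1) : E × ℝ)
  refine Eq.trans ?_ h2
  refine congrArg (fun x : E × ℝ ↦ (mfderiv (I.prod 𝓘(ℝ, ℝ)) 𝓘(ℝ, E × ℝ)
    (extChartAt (I.prod 𝓘(ℝ, ℝ)) p) ((extChartAt (I.prod 𝓘(ℝ, ℝ)) p).symm w) x : E × ℝ)) ?_
  refine Eq.trans ?_ h1.symm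
  exact Prod.ext (map_zero (mfderiv 𝓘(ℝ, E) I (extChartAt I p.1).symm w.1)).symm rfl

theorem inChart_prod_apply (Ω : DForm (I.prod 𝓘(ℝ, ℝ)) (G × ℝ) k) (g : G) (s t : ℝ)
    (v : Fin k → E × ℝ) :
    DForm.inChart (I.prod 𝓘(ℝ, ℝ)) Ω (g, s) (extChartAt I g g, t) v = Ω (g, t) v := by
  refine (DForm.pullbackVec_apply Ω _ _ v).trans ?_
  have h1 : ∀ x : E × ℝ, (mfderiv 𝓘(ℝ, E × ℝ) (I.prod 𝓘(ℝ, ℝ))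
      (extChartAt (I.prod 𝓘(ℝ, ℝ)) (g, s)).symm (extChartAt I g g, t) x : E × ℝ) = x := by
    intro x
    refine (mfderiv_extChartAt_prod_symm (p := (g, s)) (mem_extChartAt_target g) t x).trans ?_
    exact Prod.ext (mfderiv_extChartAt_symm_self_apply g x.1) rfl
  have h2 : (extChartAt (I.prod 𝓘(ℝ, ℝ)) (g, s)).symm (extChartAt I g g, t) = (g, t) := by
    rw [extChartAt_prod_real_symm]
    exact Prod.ext (extChartAt_to_inv g) rfl
  refine Eq.trans ?_ (DForm.apply_congr Ω h2 v)
  congr 1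
  funext i
  exact h1 (v i)

/-- The Lie derivative along `∂/∂s` in the chart. -/
theorem lieDeriv_partialS (Ω : DForm (I.prod 𝓘(ℝ, ℝ)) (G × ℝ) k) (p : G × ℝ)
    (v : Fin k → E × ℝ) :
    DForm.lieDeriv (I.prod 𝓘(ℝ, ℝ)) (partialS I G) Ω p v =
      fderiv ℝ (DForm.inChart (I.prod 𝓘(ℝ, ℝ)) Ω p) (extChartAt I p.1 p.1, p.2) (0, 1) v := by
  have hev : VField.inChart (I.prod 𝓘(ℝ, ℝ)) (partialS I G) p
      =ᶠ[𝓝 (extChartAt (I.prod 𝓘(ℝ, ℝ)) p p)] fun _ ↦ ((0, 1) : E × ℝ) := by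
    filter_upwards [extChartAt_target_mem_nhds p] with w hw using VField.inChart_partialS p hw
  have hfd : fderiv ℝ (VField.inChart (I.prod 𝓘(ℝ, ℝ)) (partialS I G) p)
      (extChartAt (I.prod 𝓘(ℝ, ℝ)) p p) = 0 := by
    rw [hev.fderiv_eq]; simp
  have hw : (fun i ↦ (mfderiv (I.prod 𝓘(ℝ, ℝ)) 𝓘(ℝ, E × ℝ) (extChartAt (I.prod 𝓘(ℝ, ℝ)) p) p (v i)
      : E × ℝ)) = v := funext fun i ↦ mfderiv_extChartAt_self_apply p (v i)
  simp only [DForm.lieDeriv]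
  refine Eq.trans (congrArg₂ (· + ·) rfl (Finset.sum_eq_zero fun i _ ↦ ?_)) (add_zero _ |>.trans ?_)
  · rw [hfd]
    exact (DForm.inChart (I.prod 𝓘(ℝ, ℝ)) Ω p (extChartAt (I.prod 𝓘(ℝ, ℝ)) p p)).map_coord_zero i
      (update_self i _ _)
  · rw [hev.eq_of_nhds]
    refine Eq.trans (congrArg _ hw) ?_
    rw [extChartAt_prod_real_apply]

/-- The flow of `∂/∂s` is translation in `s`. The chart at `g` is the identity on tangent vectors
along the whole line over `g`, so the vectors `v` can be kept fixed. -/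
theorem hasDerivAt_lieDeriv_partialS {Ω : DForm (I.prod 𝓘(ℝ, ℝ)) (G × ℝ) k}
    (hΩ : DForm.IsSmooth (I.prod 𝓘(ℝ, ℝ)) Ω) (g : G) (s : ℝ) (v : Fin k → E × ℝ) :
    HasDerivAt (fun t ↦ Ω (g, t) v)
      (DForm.lieDeriv (I.prod 𝓘(ℝ, ℝ)) (partialS I G) Ω (g, s) v) s := by
  rw [lieDeriv_partialS]
  have hmem := mem_extChartAt_target (I := I.prod 𝓘(ℝ, ℝ)) ((g, s) : G × ℝ)
  rw [extChartAt_prod_real_apply] at hmem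
  have h1 := ((hΩ.contDiffAt hmem).differentiableAt (by simp)).hasFDerivAt
  have h2 : HasDerivAt (fun t : ℝ ↦ ((extChartAt I g g, t) : E × ℝ)) (0, 1) s :=
    (hasDerivAt_const s _).prodMk (hasDerivAt_id s)
  have h3 := h1.comp_hasDerivAt s h2
  have h4 := ((ContinuousAlternatingMap.apply ℝ (E × ℝ) ℝ v).hasFDerivAt.comp_hasDerivAt s h3)
  refine h4.congr_of_eventuallyEq (Filter.Eventually.of_forall fun t ↦ ?_)
  exact (inChart_prod_apply Ω g s t v).symm

end Product

/-! ### Contactization as inverse of symplectization; contact versus symplectic. -/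

section Contactization

variable {E : Type*} [NormedAddCommGroup E] [NormedSpace ℝ E]
  {H : Type*} [TopologicalSpace H] {I : ModelWithCorners ℝ E H}
  {G : Type*} [TopologicalSpace G] [ChartedSpace H G]

variable (E) in
/-- The linear map `α ↦ (ι_{∂/∂s} α)|_E`. -/
noncomputable def contactLin : ((E × ℝ) [⋀^Fin 2]→L[ℝ] ℝ) →L[ℝ] E [⋀^Fin 1]→L[ℝ] ℝ :=
  ContinuousAlternatingMap.compContinuousLinearMapCLM (ContinuousLinearMap.inl ℝ E ℝ) ∘L
    ContinuousLinearMap.apply ℝ ((E × ℝ) [⋀^Fin 1]→L[ℝ] ℝ) ((0, 1) : E × ℝ) ∘L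
    ContinuousAlternatingMap.curryLeftLI.toContinuousLinearMap

theorem contactLin_apply (α : (E × ℝ) [⋀^Fin 2]→L[ℝ] ℝ) (v : E) :
    contactLin E α ![v] = α ![(0, 1), (v, 0)] := by
  change α (Fin.cons _ _) = _
  congr 1
  funext i
  fin_cases i <;> rfl

theorem isSmoothVField_partialS [IsManifold I ∞ G] : IsSmoothVField (I.prod 𝓘(ℝ, ℝ)) (partialS I G) := by
  have h0 : ContMDiff (I.prod 𝓘(ℝ, ℝ)) I.tangent ∞
      (fun p : G × ℝ ↦ (⟨p.1, 0⟩ : TangentBundle I G)) :=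
    (Bundle.contMDiff_zeroSection ℝ (TangentSpace I : G → Type _)).comp contMDiff_fst
  have h1 : ContMDiff 𝓘(ℝ, ℝ) 𝓘(ℝ, ℝ).tangent ∞
      (fun t : ℝ ↦ (⟨t, (1 : ℝ)⟩ : TangentBundle 𝓘(ℝ, ℝ) ℝ)) :=
    contMDiff_vectorSpace_iff_contDiff.2 contDiff_const
  exact contMDiff_equivTangentBundleProd_symm.comp (h0.prodMk (h1.comp contMDiff_snd))

variable [IsManifold I ∞ G] [I.Boundaryless]

theorem inChart_contactization (Ω : DForm (I.prod 𝓘(ℝ, ℝ)) (G × ℝ) 2) (g : G) {y : E}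
    (hy : y ∈ (extChartAt I g).target) :
    DForm.inChart I (contactization I Ω) g y =
      contactLin E (DForm.inChart (I.prod 𝓘(ℝ, ℝ)) Ω (g, 0) (y, 0)) := by
  ext z
  have hz : z = ![z 0] := List.ofFn_inj.mp rfl
  rw [hz, contactLin_apply]
  refine (DForm.pullbackVec_apply_one _ _ y (z 0)).trans ?_
  refine (contactization_apply Ω _ _).trans ?_
  refine Eq.trans ?_ (DForm.pullbackVec_apply_two Ω _ ((y, 0) : E × ℝ) _ _).symm
  have h1 := mfderiv_extChartAt_prod_symm (p := ((g, 0) : G × ℝ)) hy 0 ((0, 1) : E × ℝ)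
  have h2 := mfderiv_extChartAt_prod_symm (p := ((g, 0) : G × ℝ)) hy 0 ((z 0, 0) : E × ℝ)
  have h3 : ((0, 1) : E × ℝ) = (mfderiv 𝓘(ℝ, E) I (extChartAt I g).symm y (0 : E), (1 : ℝ)) :=
    Prod.ext (map_zero (mfderiv 𝓘(ℝ, E) I (extChartAt I g).symm y)).symm rfl
  have h4 : (extChartAt (I.prod 𝓘(ℝ, ℝ)) ((g, 0) : G × ℝ)).symm (y, 0) =
      ((extChartAt I g).symm y, 0) := by rw [extChartAt_prod_real_symm]
  refine Eq.trans ?_ (DForm.apply_congr Ω h4 _).symm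
  exact congrArg₂ (fun a b : E × ℝ ↦ Ω ((extChartAt I g).symm y, 0) ![a, b])
    (h3.trans h1.symm) h2.symm

theorem contactization_isSmooth {Ω : DForm (I.prod 𝓘(ℝ, ℝ)) (G × ℝ) 2}
    (hΩ : DForm.IsSmooth (I.prod 𝓘(ℝ, ℝ)) Ω) : DForm.IsSmooth I (contactization I Ω) := by
  intro g
  refine ContDiffOn.congr ?_ fun y hy ↦ inChart_contactization Ω g hy
  refine (contactLin E).contDiff.comp_contDiffOn ?_
  refine (hΩ (g, 0)).comp (contDiff_id.prodMk contDiff_const).contDiffOn fun y hy ↦ ?_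
  rw [extChartAt_prod_real_target]
  exact ⟨hy, mem_univ _⟩

/-- Cartan's formula for `∂/∂s` on a closed homogeneous form. -/
theorem d_contactization_apply {Ω : DForm (I.prod 𝓘(ℝ, ℝ)) (G × ℝ) 2}
    (hΩ : DForm.IsSmooth (I.prod 𝓘(ℝ, ℝ)) Ω) (hcl : ∀ p, DForm.d (I.prod 𝓘(ℝ, ℝ)) Ω p = 0)
    (hL : ∀ (p : G × ℝ) (v : Fin 2 → E × ℝ),
      DForm.lieDeriv (I.prod 𝓘(ℝ, ℝ)) (partialS I G) Ω p v = Ω p v) (g : G) (u v : E) :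
    DForm.d I (contactization I Ω) g ![u, v] = Ω (g, 0) ![((u, 0) : E × ℝ), (v, 0)] := by
  let y := extChartAt I g g
  have hmem := mem_extChartAt_target (I := I.prod 𝓘(ℝ, ℝ)) ((g, 0) : G × ℝ)
  rw [extChartAt_prod_real_apply] at hmem
  let D := fderiv ℝ (DForm.inChart (I.prod 𝓘(ℝ, ℝ)) Ω (g, 0)) (y, 0)
  have hD : HasFDerivAt (DForm.inChart (I.prod 𝓘(ℝ, ℝ)) Ω (g, 0)) D (y, 0) :=
    ((hΩ.contDiffAt hmem).differentiableAt (by simp)).hasFDerivAt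
  have hev : DForm.inChart I (contactization I Ω) g =ᶠ[𝓝 y]
      fun y ↦ contactLin E (DForm.inChart (I.prod 𝓘(ℝ, ℝ)) Ω (g, 0) (y, 0)) := by
    filter_upwards [extChartAt_target_mem_nhds (I := I) g] with y hy
      using inChart_contactization Ω g hy
  have hinl : HasFDerivAt (fun y : E ↦ ((y, 0) : E × ℝ)) (ContinuousLinearMap.inl ℝ E ℝ) y :=
    (hasFDerivAt_id y).prodMk (hasFDerivAt_const 0 y)
  have h1 : fderiv ℝ (DForm.inChart I (contactization I Ω) g) y =
      (contactLin E).comp (D.comp (ContinuousLinearMap.inl ℝ E ℝ)) := by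
    rw [hev.fderiv_eq]
    exact ((contactLin E).hasFDerivAt.comp y
      (f := fun y ↦ DForm.inChart (I.prod 𝓘(ℝ, ℝ)) Ω (g, 0) (y, 0)) (HasFDerivAt.comp y (f := fun y : E ↦ ((y, 0) : E × ℝ)) hD hinl)).fderiv
  have h2 : DForm.d I (contactization I Ω) g ![u, v] =
      D (u, 0) ![(0, 1), (v, 0)] - D (v, 0) ![(0, 1), (u, 0)] := by
    refine (DForm.d_apply _ g ![u, v]).trans ?_
    rw [extDeriv, h1]
    refine (alternatizeUncurryFin_two _ _ _).trans ?_
    exact congrArg₂ (· - ·) (contactLin_apply _ _) (contactLin_apply _ _)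
  -- This is `dΩ(∂/∂s, u, v) = 0`. By homogeneity its first term is `Ω(u, v)`, and the other two
  -- make up `-d(ι_{∂/∂s} Ω)(u, v)`.
  have h3 : D (0, 1) ![(u, 0), (v, 0)] - D (u, 0) ![(0, 1), (v, 0)] +
      D (v, 0) ![(0, 1), (u, 0)] = 0 := by
    have h4 := DForm.d_apply Ω (g, 0) ![((0, 1) : E × ℝ), (u, 0), (v, 0)]
    rw [hcl, extChartAt_prod_real_apply, extDeriv] at h4
    exact (alternatizeUncurryFin_three D _ _ _).symm.trans h4.symm
  have h5 : Ω (g, 0) ![((u, 0) : E × ℝ), (v, 0)] = D (0, 1) ![(u, 0), (v, 0)] :=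
    (hL (g, 0) ![(u, 0), (v, 0)]).symm.trans (lieDeriv_partialS Ω (g, 0) _)
  rw [h2, h5]
  linarith

/-- A form which is homogeneous with respect to `∂/∂s` depends exponentially on `s`. -/
theorem apply_eq_exp_mul {k : ℕ} {Ω : DForm (I.prod 𝓘(ℝ, ℝ)) (G × ℝ) k}
    (hΩ : DForm.IsSmooth (I.prod 𝓘(ℝ, ℝ)) Ω)
    (hL : ∀ (p : G × ℝ) (v : Fin k → E × ℝ),
      DForm.lieDeriv (I.prod 𝓘(ℝ, ℝ)) (partialS I G) Ω p v = Ω p v) (g : G) (s : ℝ)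
    (v : Fin k → E × ℝ) : Ω (g, s) v = Real.exp s * Ω (g, 0) v := by
  -- Homogeneity is the equation `f' = f` in `s`; the integrating factor `e^{-t}` makes the product
  -- constant.
  have h1 : ∀ t, HasDerivAt (fun t ↦ Real.exp (-t) * Ω (g, t) v) 0 t := by
    intro t
    have h2 := hasDerivAt_lieDeriv_partialS hΩ g t v
    rw [hL] at h2
    have h3 : HasDerivAt (fun t : ℝ ↦ Real.exp (-t)) (Real.exp (-t) * -1) t :=
      (hasDerivAt_neg t).exp
    refine (h3.mul h2).congr_deriv ?_
    ring
  have h4 := is_const_of_deriv_eq_zero (fun t ↦ (h1 t).differentiableAt) (fun t ↦ (h1 t).deriv) s 0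
  simp only [neg_zero, Real.exp_zero, one_mul] at h4
  rw [← h4, ← mul_assoc, ← Real.exp_add]
  simp

/-- The decomposition `α = ds ∧ ι_{∂/∂s} α + α|_E`, in the shape of the right-hand side of
`symplectization_apply`. -/
theorem two_form_apply_prod (α : (E × ℝ) [⋀^Fin 2]→L[ℝ] ℝ) (u v : E) (a b : ℝ) :
    α ![(u, a), (v, b)] =
      a * α ![(0, 1), (v, 0)] - b * α ![(0, 1), (u, 0)] + α ![(u, 0), (v, 0)] := by
  have h1 : ∀ (w : E) (c : ℝ), ((w, c) : E × ℝ) = c • (0, 1) + (w, 0) := by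
    intro w c
    simp
  have h2 := formToBilin_isAlt α ((0, 1) : E × ℝ)
  have h3 : formToBilin α (u, a) (v, b) = a * formToBilin α (0, 1) (v, 0) -
      b * formToBilin α (0, 1) (u, 0) + formToBilin α (u, 0) (v, 0) := by
    rw [h1 u a, h1 v b]
    simp only [map_add, map_smul, LinearMap.add_apply, LinearMap.smul_apply, smul_eq_mul, h2]
    rw [← (formToBilin_isAlt α).neg (0, 1) (u, 0)]
    ring
  exact h3

/-- A closed homogeneous form is determined by its contactization. -/
theorem symplectization_contactization {Ω : DForm (I.prod 𝓘(ℝ, ℝ)) (G × ℝ) 2}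
    (hΩ : DForm.IsSmooth (I.prod 𝓘(ℝ, ℝ)) Ω) (hcl : ∀ p, DForm.d (I.prod 𝓘(ℝ, ℝ)) Ω p = 0)
    (hL : ∀ (p : G × ℝ) (v : Fin 2 → E × ℝ),
      DForm.lieDeriv (I.prod 𝓘(ℝ, ℝ)) (partialS I G) Ω p v = Ω p v) :
    symplectization I (contactization I Ω) = Ω := by
  funext p
  obtain ⟨g, s⟩ := p
  refine ContinuousAlternatingMap.ext (M := E × ℝ) fun z ↦ ?_
  have hz : z = ![((z 0).1, (z 0).2), ((z 1).1, (z 1).2)] := by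
    funext i; fin_cases i <;> rfl
  rw [hz]
  refine (symplectization_apply (contactization_isSmooth hΩ) g s _ _ _ _).trans ?_
  refine Eq.trans ?_ (apply_eq_exp_mul hΩ hL g s _).symm
  rw [contactization_apply, contactization_apply, d_contactization_apply hΩ hcl hL]
  exact congrArg _ (two_form_apply_prod (Ω (g, 0)) _ _ _ _).symm

theorem contactization_symplectization {θ : DForm I G 1} (hθ : DForm.IsSmooth I θ) :
    contactization I (symplectization I θ) = θ := by
  funext g
  refine ContinuousAlternatingMap.ext (M := E) fun z ↦ ?_
  have hz : z = ![z 0] := List.ofFn_inj.mp rfl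
  rw [hz]
  refine (contactization_apply _ g _).trans ((symplectization_apply hθ g 0 _ _ _ _).trans ?_)
  have h1 : DForm.d I θ g ![(0 : E), z 0] = 0 :=
    (DForm.d I θ g).map_coord_zero (m := ![(0 : E), z 0]) 0 rfl
  rw [h1, Real.exp_zero, one_mul, one_mul, zero_mul, sub_zero, add_zero]
  rfl

theorem lieDeriv_symplectization {θ : DForm I G 1} (hθ : DForm.IsSmooth I θ) (p : G × ℝ)
    (v : Fin 2 → E × ℝ) :
    DForm.lieDeriv (I.prod 𝓘(ℝ, ℝ)) (partialS I G) (symplectization I θ) p v =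
      symplectization I θ p v := by
  obtain ⟨g, s⟩ := p
  have h1 := hasDerivAt_lieDeriv_partialS (expForm_isSmooth hθ).d g s v
  have hv : v = ![((v 0).1, (v 0).2), ((v 1).1, (v 1).2)] := by
    funext i; fin_cases i <;> rfl
  have h2 : ∀ t, symplectization I θ (g, t) v = Real.exp t * symplectization I θ (g, 0) v := by
    intro t
    rw [hv]
    refine (symplectization_apply hθ g t _ _ _ _).trans ?_
    refine Eq.trans ?_ (congrArg _ (symplectization_apply hθ g 0 _ _ _ _).symm)
    simp
  have h3 : HasDerivAt (fun t ↦ symplectization I θ (g, t) v)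
      (Real.exp s * symplectization I θ (g, 0) v) s := by
    rw [funext h2]
    exact (Real.hasDerivAt_exp s).mul_const _
  exact (h1.unique h3).trans (h2 s).symm

/-- `θ` is a contact form if and only if `d(eˢ θ)` is a symplectic form. -/
theorem isContactForm_iff [FiniteDimensional ℝ E] {θ : DForm I G 1} (hθ : DForm.IsSmooth I θ) :
    IsContactForm I θ ↔ IsSymplecticForm (I.prod 𝓘(ℝ, ℝ)) (symplectization I θ) := by
  have key : ∀ (g : G) (s : ℝ), (∀ U : E × ℝ, (∀ V : E × ℝ,
      symplectization I θ (g, s) ![U, V] = 0) → U = 0) ↔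
      ∀ (u : E) (a : ℝ), θ g ![u] = 0 →
        (∀ w : E, a * θ g ![w] + DForm.d I θ g ![u, w] = 0) → u = 0 ∧ a = 0 := by
    intro g s
    constructor
    · intro h u a hu hw
      have := h (u, a) fun V ↦ by
        refine (symplectization_apply hθ g s u V.1 a V.2).trans ?_
        rw [hu]
        linear_combination Real.exp s * hw V.1
      exact Prod.ext_iff.1 this
    · rintro h ⟨u, a⟩ hU
      have h1 : ∀ (v : E) (b : ℝ), a * θ g ![v] - b * θ g ![u] + DForm.d I θ g ![u, v] = 0 :=
        fun v b ↦ (mul_eq_zero.1 ((symplectization_apply hθ g s u v a b).symm.trans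
          (hU (v, b)))).resolve_left (Real.exp_ne_zero s)
      have h2 : ∀ w : E, a * θ g ![w] + DForm.d I θ g ![u, w] = 0 := fun w ↦ by
        simpa using h1 w 0
      -- Testing against `(0, 1)` and `(0, 0)` and subtracting isolates `θ(u)`.
      have h3 : θ g ![u] = 0 := by linarith [h1 0 1, h1 0 0]
      obtain ⟨h4, h5⟩ := h u a h3 h2
      exact Prod.ext h4 h5
  constructor
  · rintro ⟨-, h⟩
    refine ⟨(expForm_isSmooth hθ).d, (expForm_isSmooth hθ).d_d, fun p ↦ ?_⟩
    exact (key p.1 p.2).2 ((exists_wedgePow_ne_zero_iff (E := E) (θ p.1) (DForm.d I θ p.1)).1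
      (h p.1))
  · rintro ⟨-, -, h⟩
    exact ⟨hθ, fun g ↦ (exists_wedgePow_ne_zero_iff (E := E) (θ g) (DForm.d I θ g)).2
      ((key g 0).1 (h (g, 0)))⟩

end Contactization

/-! ### Multiplicativity on `Σ ×_r ℝ`. -/

namespace LieGroupoid

variable {E : Type*} [NormedAddCommGroup E] [NormedSpace ℝ E]
  {H : Type*} [TopologicalSpace H] {I : ModelWithCorners ℝ E H}
  {F : Type*} [NormedAddCommGroup F] [NormedSpace ℝ F]
  {K : Type*} [TopologicalSpace K] {J : ModelWithCorners ℝ F K}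
  {G : Type*} [TopologicalSpace G] [ChartedSpace H G]
  {M : Type*} [TopologicalSpace M] [ChartedSpace K M]

theorem mfderiv_map_id_real {f : G → M} {p : G × ℝ} (hf : MDifferentiableAt I J f p.1)
    (u : E) (a : ℝ) :
    (mfderiv (I.prod 𝓘(ℝ, ℝ)) (J.prod 𝓘(ℝ, ℝ)) (fun p : G × ℝ ↦ (f p.1, p.2)) p
      ((u, a) : E × ℝ) : F × ℝ) = (mfderiv I J f p.1 u, a) := by
  have h1 : HasMFDerivAt (I.prod 𝓘(ℝ, ℝ)) J (fun p : G × ℝ ↦ f p.1) p _ :=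
    HasMFDerivAt.comp p (f := (Prod.fst : G × ℝ → G)) hf.hasMFDerivAt (hasMFDerivAt_fst p)
  have h2 := (h1.prodMk (hasMFDerivAt_snd (I := I) (I' := 𝓘(ℝ, ℝ)) p)).mfderiv
  exact congrArg (fun L : E × ℝ →L[ℝ] F × ℝ ↦ L (u, a)) h2

variable (I) in
/-- The differential of a real function, as a linear form on the model space. -/
noncomputable def realDifferential (r : G → ℝ) (g : G) : E →L[ℝ] ℝ := mfderiv I 𝓘(ℝ, ℝ) r g

theorem mfderiv_map_sub {f : G → M} {r : G → ℝ} {p : G × ℝ} (hf : MDifferentiableAt I J f p.1)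
    (hr : MDifferentiableAt I 𝓘(ℝ, ℝ) r p.1) (u : E) (a : ℝ) :
    (mfderiv (I.prod 𝓘(ℝ, ℝ)) (J.prod 𝓘(ℝ, ℝ)) (fun p : G × ℝ ↦ (f p.1, p.2 - r p.1)) p
      ((u, a) : E × ℝ) : F × ℝ) =
      (mfderiv I J f p.1 u, a - realDifferential I r p.1 u) := by
  have h1 : HasMFDerivAt (I.prod 𝓘(ℝ, ℝ)) J (fun p : G × ℝ ↦ f p.1) p _ :=
    HasMFDerivAt.comp p (f := (Prod.fst : G × ℝ → G)) hf.hasMFDerivAt (hasMFDerivAt_fst p)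
  have hR : HasMFDerivAt (I.prod 𝓘(ℝ, ℝ)) 𝓘(ℝ, ℝ) (fun p : G × ℝ ↦ r p.1) p
      ((realDifferential I r p.1).comp (ContinuousLinearMap.fst ℝ E ℝ)) :=
    HasMFDerivAt.comp p (f := (Prod.fst : G × ℝ → G)) hr.hasMFDerivAt (hasMFDerivAt_fst p)
  have hs : HasMFDerivAt (I.prod 𝓘(ℝ, ℝ)) 𝓘(ℝ, ℝ) (fun p : G × ℝ ↦ p.2) p
      (ContinuousLinearMap.snd ℝ E ℝ) := hasMFDerivAt_snd p
  have h3 : HasMFDerivAt (I.prod 𝓘(ℝ, ℝ)) 𝓘(ℝ, ℝ) (fun p : G × ℝ ↦ p.2 - r p.1) p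
      (ContinuousLinearMap.snd ℝ E ℝ -
        (realDifferential I r p.1).comp (ContinuousLinearMap.fst ℝ E ℝ)) := hs.sub hR
  have h2 := (h1.prodMk h3).mfderiv
  exact congrArg (fun L : E × ℝ →L[ℝ] F × ℝ ↦ L (u, a)) h2

variable [IsManifold I ∞ G] [IsManifold J ∞ M] (𝒢 : LieGroupoid I J G M) {r : G → ℝ}
  (hr : ContMDiff I 𝓘(ℝ, ℝ) ∞ r) (hm : 𝒢.IsMultiplicativeFun r)

theorem mfderiv_twistedProd_src (p : G × ℝ) (u : E) (a : ℝ) :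
    (mfderiv (I.prod 𝓘(ℝ, ℝ)) (J.prod 𝓘(ℝ, ℝ)) (𝒢.twistedProd r hr hm).src p
      ((u, a) : E × ℝ) : F × ℝ) = (mfderiv I J 𝒢.src p.1 u, a) :=
  mfderiv_map_id_real (𝒢.submersion_src.contMDiff.mdifferentiableAt (by simp)) u a

theorem mfderiv_twistedProd_tgt (p : G × ℝ) (u : E) (a : ℝ) :
    (mfderiv (I.prod 𝓘(ℝ, ℝ)) (J.prod 𝓘(ℝ, ℝ)) (𝒢.twistedProd r hr hm).tgt p
      ((u, a) : E × ℝ) : F × ℝ) =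
      (mfderiv I J 𝒢.tgt p.1 u, a - realDifferential I r p.1 u) :=
  mfderiv_map_sub (𝒢.submersion_tgt.contMDiff.mdifferentiableAt (by simp))
    (hr.mdifferentiableAt (by simp)) u a

theorem twistedProd_tangentComposable_iff {g h : G} {s t : ℝ} (u v : E) (a b : ℝ) :
    (𝒢.twistedProd r hr hm).TangentComposable (g := (g, s)) (h := (h, t))
      ((u, a) : E × ℝ) ((v, b) : E × ℝ) ↔
      𝒢.TangentComposable (g := g) (h := h) u v ∧ s = t - r h ∧
        a = b - realDifferential I r h v := by
  have h1 : (𝒢.twistedProd r hr hm).src (g, s) = (𝒢.twistedProd r hr hm).tgt (h, t) ↔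
      𝒢.src g = 𝒢.tgt h ∧ s = t - r h := Prod.mk_inj
  have h2 : (mfderiv (I.prod 𝓘(ℝ, ℝ)) (J.prod 𝓘(ℝ, ℝ)) (𝒢.twistedProd r hr hm).src (g, s)
      ((u, a) : E × ℝ) : F × ℝ) =
      mfderiv (I.prod 𝓘(ℝ, ℝ)) (J.prod 𝓘(ℝ, ℝ)) (𝒢.twistedProd r hr hm).tgt (h, t)
      ((v, b) : E × ℝ) ↔
      (mfderiv I J 𝒢.src g u : F) = mfderiv I J 𝒢.tgt h v ∧
        a = b - realDifferential I r h v := by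
    refine Iff.trans (Eq.congr (mfderiv_twistedProd_src 𝒢 hr hm (g, s) u a)
      (mfderiv_twistedProd_tgt 𝒢 hr hm (h, t) v b)) ?_
    exact Prod.mk_inj
  refine ((tangentComposable_iff _ _ _).trans (and_congr h1 h2)).trans ?_
  refine Iff.trans ?_ (and_congr_left' (tangentComposable_iff 𝒢 (g := g) (h := h) u v).symm)
  tauto

/-- The obvious candidate for the derivative of the product is a derivative within the composable
pairs. It need not be the one chosen by `mfderivWithin`, but by `tangentMul_eq` they agree on
composable vectors. -/
theorem twistedProd_tangentMul [I.Boundaryless] {g h : G} {s t : ℝ} {u v : E} {a b : ℝ}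
    (hc : (𝒢.twistedProd r hr hm).TangentComposable (g := (g, s)) (h := (h, t))
      ((u, a) : E × ℝ) ((v, b) : E × ℝ)) :
    ((𝒢.twistedProd r hr hm).tangentMul (g := (g, s)) (h := (h, t))
      ((u, a) : E × ℝ) ((v, b) : E × ℝ) : E × ℝ) =
      (𝒢.tangentMul (g := g) (h := h) u v, b) := by
  have hcomp := ((tangentComposable_iff _ _ _).1 hc).1
  have hgh : 𝒢.src g = 𝒢.tgt h := (Prod.mk_inj.1 hcomp).1
  let L₀ : E × E →L[ℝ] E :=
    mfderivWithin (I.prod I) I (fun q : G × G ↦ 𝒢.mul q.1 q.2) 𝒢.composable (g, h)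
  have hL₀ : HasMFDerivWithinAt (I.prod I) I (fun q : G × G ↦ 𝒢.mul q.1 q.2) 𝒢.composable
      (g, h) L₀ := (𝒢.mdifferentiableWithinAt_mul hgh).hasMFDerivWithinAt
  let π : (E × ℝ) × (E × ℝ) →L[ℝ] E × E :=
    (ContinuousLinearMap.fst ℝ E ℝ).prodMap (ContinuousLinearMap.fst ℝ E ℝ)
  let f : (G × ℝ) × (G × ℝ) → G × G := fun q ↦ (q.1.1, q.2.1)
  let q₀ : (G × ℝ) × (G × ℝ) := ((g, s), (h, t))
  have hf : HasMFDerivAt ((I.prod 𝓘(ℝ, ℝ)).prod (I.prod 𝓘(ℝ, ℝ))) (I.prod I) f q₀ π :=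
    (HasMFDerivAt.comp q₀ (hasMFDerivAt_fst (g, s)) (hasMFDerivAt_fst q₀)).prodMk
      (HasMFDerivAt.comp q₀ (hasMFDerivAt_fst (h, t)) (hasMFDerivAt_snd q₀))
  have hsnd : HasMFDerivAt ((I.prod 𝓘(ℝ, ℝ)).prod (I.prod 𝓘(ℝ, ℝ))) 𝓘(ℝ, ℝ)
      (fun q : (G × ℝ) × (G × ℝ) ↦ q.2.2) q₀
      ((ContinuousLinearMap.snd ℝ E ℝ).comp (ContinuousLinearMap.snd ℝ (E × ℝ) (E × ℝ))) :=
    HasMFDerivAt.comp q₀ (hasMFDerivAt_snd (h, t)) (hasMFDerivAt_snd q₀)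
  have h1 : HasMFDerivWithinAt ((I.prod 𝓘(ℝ, ℝ)).prod (I.prod 𝓘(ℝ, ℝ))) I
      (fun q : (G × ℝ) × (G × ℝ) ↦ 𝒢.mul q.1.1 q.2.1) (𝒢.twistedProd r hr hm).composable q₀
      (L₀.comp π) :=
    HasMFDerivWithinAt.comp q₀ (f := f) hL₀ hf.hasMFDerivWithinAt
      fun q hq ↦ (Prod.mk_inj.1 hq).1
  have h2 := (𝒢.twistedProd r hr hm).tangentMul_eq (g := (g, s)) (h := (h, t)) hcomp
    (L := (L₀.comp π).prod
      ((ContinuousLinearMap.snd ℝ E ℝ).comp (ContinuousLinearMap.snd ℝ (E × ℝ) (E × ℝ))))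
    (h1.prodMk hsnd.hasMFDerivWithinAt) hc
  exact h2

/-- Translations in `s` commute with all structure maps, since `r` does not depend on `s`. The base
field is `∂/∂s` on `M × ℝ`. -/
theorem isMultiplicativeVField_partialS [I.Boundaryless] :
    (𝒢.twistedProd r hr hm).IsMultiplicativeVField (partialS I G) := by
  have hsrc : ∀ p : G × ℝ, tangentMap (I.prod 𝓘(ℝ, ℝ)) (J.prod 𝓘(ℝ, ℝ))
      (𝒢.twistedProd r hr hm).src ⟨p, partialS I G p⟩ =
      ⟨(𝒢.twistedProd r hr hm).src p, partialS J M ((𝒢.twistedProd r hr hm).src p)⟩ := by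
    intro p
    refine congrArg (Bundle.TotalSpace.mk _) ?_
    refine (mfderiv_twistedProd_src 𝒢 hr hm p 0 1).trans ?_
    exact Prod.ext (map_zero (mfderiv I J 𝒢.src p.1)) rfl
  have htgt : ∀ p : G × ℝ, tangentMap (I.prod 𝓘(ℝ, ℝ)) (J.prod 𝓘(ℝ, ℝ))
      (𝒢.twistedProd r hr hm).tgt ⟨p, partialS I G p⟩ =
      ⟨(𝒢.twistedProd r hr hm).tgt p, partialS J M ((𝒢.twistedProd r hr hm).tgt p)⟩ := by
    intro p
    refine congrArg (Bundle.TotalSpace.mk _) ?_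
    refine (mfderiv_twistedProd_tgt 𝒢 hr hm p 0 1).trans ?_
    refine Prod.ext (map_zero (mfderiv I J 𝒢.tgt p.1)) ?_
    change (1 : ℝ) - realDifferential I r p.1 0 = 1
    rw [map_zero, sub_zero]
  refine ⟨isSmoothVField_partialS, partialS J M, isSmoothVField_partialS, hsrc, htgt, ?_, ?_⟩
  · intro x
    refine congrArg (Bundle.TotalSpace.mk _) ?_
    refine (mfderiv_map_id_real (f := 𝒢.one) (p := x)
      (𝒢.smooth_one.mdifferentiableAt (by simp)) 0 1).trans ?_
    exact Prod.ext (map_zero (mfderiv J I 𝒢.one x.1)) rfl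
  · intro p q hpq
    have hc : (𝒢.twistedProd r hr hm).TangentComposable (partialS I G p) (partialS I G q) := by
      refine (hsrc p).trans (Eq.trans ?_ (htgt q).symm)
      rw [hpq]
    refine (twistedProd_tangentMul 𝒢 hr hm (g := p.1) (h := q.1) (s := p.2) (t := q.2)
      (u := 0) (v := 0) (a := 1) (b := 1) hc).trans ?_
    exact Prod.ext (map_zero (mfderivWithin (I.prod I) I (fun q : G × G ↦ 𝒢.mul q.1 q.2)
      𝒢.composable (p.1, q.1))) rfl

theorem expForm_isMultiplicative_iff [I.Boundaryless] (θ : DForm I G 1) :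
    (𝒢.twistedProd r hr hm).IsMultiplicativeOneForm (expForm I θ) ↔
    ∀ g h, 𝒢.src g = 𝒢.tgt h → ∀ (u : TangentSpace I g) (v : TangentSpace I h),
      𝒢.TangentComposable u v →
        θ (𝒢.mul g h) ![𝒢.tangentMul u v] = Real.exp (-r h) * θ g ![u] + θ h ![v] := by
  have key : ∀ {g h : G} {s t : ℝ} {u v : E} {a b : ℝ},
      (𝒢.twistedProd r hr hm).TangentComposable (g := (g, s)) (h := (h, t))
        ((u, a) : E × ℝ) ((v, b) : E × ℝ) →
      expForm I θ ((𝒢.twistedProd r hr hm).mul (g, s) (h, t))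
        ![(𝒢.twistedProd r hr hm).tangentMul (g := (g, s)) (h := (h, t))
          ((u, a) : E × ℝ) ((v, b) : E × ℝ)] =
        Real.exp t * θ (𝒢.mul g h) ![𝒢.tangentMul (g := g) (h := h) u v] := by
    intro g h s t u v a b hc
    refine (congrArg (fun x : E × ℝ ↦ expForm I θ (𝒢.mul g h, t) ![x])
      (twistedProd_tangentMul 𝒢 hr hm hc)).trans ?_
    exact expForm_apply θ (𝒢.mul g h, t) _ b
  constructor
  · intro hΘ g h hgh u v huv
    -- Every composable pair and composable vectors of `Σ` lift to `Σ ×_r ℝ`: with height `0` and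
    -- velocity `0` for the second arrow, those of the first are forced to be `-r(h)` and `-dr(v)`.
    let a : ℝ := 0 - realDifferential I r h v
    have hc := (twistedProd_tangentComposable_iff 𝒢 hr hm (g := g) (h := h) (s := 0 - r h) (t := 0)
      u v a 0).2 ⟨huv, rfl, rfl⟩
    have h1 := hΘ (g, 0 - r h) (h, 0) (Prod.ext hgh rfl) _ _ hc
    rw [key hc] at h1
    have h2 := h1.trans (congrArg₂ (· + ·) (expForm_apply θ (g, 0 - r h) u a)
      (expForm_apply θ (h, 0) v 0))
    simpa using h2
  · rintro hθ ⟨g, s⟩ ⟨h, t⟩ hpq ⟨u, a⟩ ⟨v, b⟩ hc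
    obtain ⟨h1, h2, -⟩ := (twistedProd_tangentComposable_iff 𝒢 hr hm u v a b).1 hc
    have hgh : 𝒢.src g = 𝒢.tgt h := (Prod.mk_inj.1 hpq).1
    refine (key hc).trans ?_
    refine Eq.trans ?_ (congrArg₂ (· + ·) (expForm_apply θ (g, s) u a)
      (expForm_apply θ (h, t) v b)).symm
    rw [hθ g h hgh u v h1]
    simp only [h2, sub_eq_add_neg, Real.exp_add]
    ring

/-- The identity `ι_{∂/∂s} d(eˢ θ) = eˢ θ`: the potential is recovered from the 2-form. -/
theorem symplectization_partialS_apply [I.Boundaryless] {θ : DForm I G 1}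
    (hθ : DForm.IsSmooth I θ) (p : G × ℝ) (V : E × ℝ) :
    symplectization I θ p ![((0, 1) : E × ℝ), V] = expForm I θ p ![V] := by
  refine (symplectization_apply hθ p.1 p.2 0 V.1 1 V.2).trans ?_
  refine Eq.trans ?_ (expForm_apply θ p V.1 V.2).symm
  have h1 : DForm.d I θ p.1 ![(0 : E), V.1] = 0 :=
    (DForm.d I θ p.1).map_coord_zero (m := ![(0 : E), V.1]) 0 rfl
  have h2 : θ p.1 ![(0 : E)] = 0 := (θ p.1).map_coord_zero (m := ![(0 : E)]) 0 rfl
  rw [h1, h2]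
  ring

/-- `θ` satisfies the contact multiplicativity condition if and only if `d(eˢ θ)` is
multiplicative on `Σ ×_r ℝ`. -/
theorem symplectization_isMultiplicative_iff [I.Boundaryless] {θ : DForm I G 1}
    (hθ : DForm.IsSmooth I θ) :
    (𝒢.twistedProd r hr hm).IsMultiplicativeForm (symplectization I θ) ↔
      (𝒢.twistedProd r hr hm).IsMultiplicativeOneForm (expForm I θ) := by
  refine ⟨fun h p q hpq U V hc ↦ ?_, fun h ↦ h.d (expForm_isSmooth hθ)⟩
  -- The values of `∂/∂s` at `p` and `q` are composable with product `∂/∂s`, so they can fill the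
  -- first slot of the multiplicative 2-form.
  obtain ⟨-, Z₀, -, hs, ht, -, hmul⟩ := isMultiplicativeVField_partialS 𝒢 hr hm
  have hZ : (𝒢.twistedProd r hr hm).TangentComposable (partialS I G p) (partialS I G q) := by
    refine (hs p).trans (Eq.trans ?_ (ht q).symm)
    rw [hpq]
  have h1 := h p q hpq _ U _ V hZ hc
  rw [hmul p q hpq] at h1
  refine (symplectization_partialS_apply hθ _ _).symm.trans (h1.trans ?_)
  exact congrArg₂ (· + ·) (symplectization_partialS_apply hθ p U)
    (symplectization_partialS_apply hθ q V)

/-- For a smooth `θ` the conditions on the field and homogeneity hold automatically; what remains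
matches clause by clause. -/
theorem isHomogeneousSymplectic_symplectization_iff [FiniteDimensional ℝ E] [I.Boundaryless]
    {θ : DForm I G 1} (hθ : DForm.IsSmooth I θ) :
    (𝒢.twistedProd r hr hm).IsHomogeneousSymplectic (symplectization I θ) (partialS I G) ↔
      𝒢.IsContactStructure θ r := by
  rw [IsHomogeneousSymplectic, IsContactStructure, isContactForm_iff hθ,
    symplectization_isMultiplicative_iff 𝒢 hr hm hθ, expForm_isMultiplicative_iff 𝒢 hr hm θ]
  exact and_congr_right fun _ ↦ and_iff_left
    ⟨isMultiplicativeVField_partialS 𝒢 hr hm, lieDeriv_symplectization hθ⟩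

end LieGroupoid

end ContactGroupoid

theorem mainTheorem6
    {E : Type*} [NormedAddCommGroup E] [NormedSpace ℝ E] [FiniteDimensional ℝ E]
    {H : Type*} [TopologicalSpace H] (I : ModelWithCorners ℝ E H) [I.Boundaryless]
    {F : Type*} [NormedAddCommGroup F] [NormedSpace ℝ F] [FiniteDimensional ℝ F]
    {K : Type*} [TopologicalSpace K] (J : ModelWithCorners ℝ F K) [J.Boundaryless]
    {G : Type*} [TopologicalSpace G] [ChartedSpace H G] [IsManifold I ∞ G]
    {M : Type*} [TopologicalSpace M] [ChartedSpace K M] [IsManifold J ∞ M]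
    (𝒢 : ContactGroupoid.LieGroupoid I J G M)
    (r : G → ℝ) (hr : ContMDiff I 𝓘(ℝ, ℝ) ∞ r) (hm : 𝒢.IsMultiplicativeFun r) :
    Set.BijOn (ContactGroupoid.symplectization I)
      {θ : ContactGroupoid.DForm I G 1 | 𝒢.IsContactStructure θ r}
      {Ω : ContactGroupoid.DForm (I.prod 𝓘(ℝ, ℝ)) (G × ℝ) 2 |
        (𝒢.twistedProd r hr hm).IsHomogeneousSymplectic Ω (ContactGroupoid.partialS I G)} ∧
    Set.InvOn (ContactGroupoid.contactization I) (ContactGroupoid.symplectization I)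
      {θ : ContactGroupoid.DForm I G 1 | 𝒢.IsContactStructure θ r}
      {Ω : ContactGroupoid.DForm (I.prod 𝓘(ℝ, ℝ)) (G × ℝ) 2 |
        (𝒢.twistedProd r hr hm).IsHomogeneousSymplectic Ω (ContactGroupoid.partialS I G)} := by
  have hinv : Set.InvOn (ContactGroupoid.contactization I) (ContactGroupoid.symplectization I)
      {θ : ContactGroupoid.DForm I G 1 | 𝒢.IsContactStructure θ r}
      {Ω : ContactGroupoid.DForm (I.prod 𝓘(ℝ, ℝ)) (G × ℝ) 2 |
        (𝒢.twistedProd r hr hm).IsHomogeneousSymplectic Ω (ContactGroupoid.partialS I G)} :=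
    ⟨fun θ hθ ↦ ContactGroupoid.contactization_symplectization hθ.1.1,
      fun Ω hΩ ↦ ContactGroupoid.symplectization_contactization hΩ.1.1 hΩ.1.2.1 hΩ.2.2.2⟩
  refine ⟨hinv.bijOn (fun θ hθ ↦ ?_) fun Ω hΩ ↦ ?_, hinv⟩
  · exact (ContactGroupoid.LieGroupoid.isHomogeneousSymplectic_symplectization_iff 𝒢 hr hm
      hθ.1.1).2 hθ
  -- `Ω` is the symplectization of its smooth contactization, so the same equivalence, read in
  -- reverse, gives surjectivity.
  · refine (ContactGroupoid.LieGroupoid.isHomogeneousSymplectic_symplectization_iff 𝒢 hr hm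
      (ContactGroupoid.contactization_isSmooth hΩ.1.1)).1 ?_
    rw [hinv.2 hΩ]
    exact hΩ
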